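/- Let $a:[0,\infty)\to(0,\infty)$ be log-concave (that is, $t\mapsto\log a(t)$ is concave on $[0,\infty)$) with $\log a(t)/t\to-\infty$ as $t\to\infty$, and put $a_n=a(n)$ for $n=0,1,2,\dots$. Let $f(z)=\sum_{n\ge0}\phi_n a_n z^n$, where $\phi_0,\phi_1,\dots$ are independent standard complex Gaussian random variables (each with density $\pi^{-1}e^{-|z|^2}$ on $\mathbb C$). For $r>0$ set $$p_H(r)=-\log\mathbb P\big(f(z)\ne0\text{ for all }|z|<r\big),\qquad S(r)=2\sum_{n\ge0:\ a_nr^n\ge1}\log(a_nr^n).$$ Then there is a (deterministic) measurable set $E\subset[1,\infty)$ of finite logarithmic measure, $\int_E\frac{dt}{t}<\infty$, depending only on $a$, such that $$p_H(r)=S(r)+o(S(r))\qquad\text{as } r\to\infty,\ r\notin E.$$ -/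

import Mathlib

open MeasureTheory ProbabilityTheory Filter Topology Asymptotics

noncomputable section

/-- The standard complex Gaussian law on `ℂ`, with density `π⁻¹ exp (-|z|²)` with respect to
the Lebesgue measure. -/
def stdComplexGaussian : Measure ℂ :=
  volume.withDensity fun z => ENNReal.ofReal (Real.pi⁻¹ * Real.exp (-‖z‖ ^ 2))

/-- The power series `f(z) = ∑ φ_n a_n z^n` for the coefficient sequences `φ` and `a`. -/
def gaussianSeries (a : ℕ → ℝ) (φ : ℕ → ℂ) (z : ℂ) : ℂ :=
  ∑' n : ℕ, φ n * (a n : ℂ) * z ^ n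

/-- The event that `f(z) = ∑ φ_n a_n z^n` has no zeros in the disk `|z| < r`. (Where the series
does not converge, the value of the sum is `0`, so the event includes convergence in the disk.) -/
def holeEvent {Ω : Type*} (a : ℕ → ℝ) (φ : ℕ → Ω → ℂ) (r : ℝ) : Set Ω :=
  {ω | ∀ z : ℂ, ‖z‖ < r → gaussianSeries a (fun n => φ n ω) z ≠ 0}

/-- `p_H(r) = - log P_H(r)`, where `P_H(r)` is the hole probability. -/
def pHole {Ω : Type*} [MeasurableSpace Ω] (P : Measure Ω) (a : ℕ → ℝ) (φ : ℕ → Ω → ℂ)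
    (r : ℝ) : ℝ :=
  -Real.log (P.real (holeEvent a φ r))

/-- The set of indices `n` with `a_n r^n ≥ 1`. -/
def significantIndices (a : ℕ → ℝ) (r : ℝ) : Set ℕ :=
  {n | 1 ≤ a n * r ^ n}

/-- `S(r) = 2 ∑ log (a_n r^n)`, the sum over the (finitely many) `n` with `a_n r^n ≥ 1`. -/
def holeExponent (a : ℕ → ℝ) (r : ℝ) : ℝ :=
  2 * ∑ᶠ n ∈ significantIndices a r, Real.log (a n * r ^ n)

/-- A measurable set `E ⊆ [1, ∞)` with `∫_E dt / t < ∞`. -/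
def HasFiniteLogMeasure (E : Set ℝ) : Prop :=
  MeasurableSet E ∧ E ⊆ Set.Ici 1 ∧ ∫⁻ t in E, ENNReal.ofReal (1 / t) < ⊤

end

open scoped ENNReal

/-! ### Products of lower Lebesgue integrals -/

/-! Write S = S(r), and let N = `cutoff a r` be the first index from which on a_n r^n < 1. For large
r, log-concavity makes a_n r^n ≥ 1 for 1 ≤ n < N, so that ∏_{n<N} (a_n r^n)^2 equals e^S up to a
factor depending only on a_0. Both bounds compare the hole probability with the inverse of this
product.

Lower bound (`le_measure_holeEvent`). There are no zeros if the constant term dominates: |φ_0| a_0 ≥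
2, each later term below index 2N is at most 1/(2N) on the circle, and the remaining terms have
absolute sum below 1/2. By independence this costs a factor of order (N max(1, a_n r^n))^{-2} for
each n, hence e^{-S - O(N log N)} in total.

Upper bound (`measure_holeEvent_le`). If f has no zeros, log|f| is harmonic. Averaging its sum over
the vertices of a regular N-gon, rotated around the circle, gives N log|f(0)|, and Jensen's
inequality for exp bounds the mean of ∏_j |f(ζ_j)|^{ε-2} below by |f(0)|^{-(2-ε)N}. This product has
small expectation: given the coefficients of index ≥ N, the N values are an affine image of the
first N coefficients, with squared Jacobian modulus N^N ∏ (a_n r^n)^2, while |ζ|^{ε-2} is integrable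
on a disk of radius R. Since log R = O(S), the choice ε = 1/log R keeps R^ε bounded and 1/ε of order
S, and Markov's inequality gives (C S^2)^N e^{-S}.

The errors N log N and N log S must be o(S). Since S grows at rate at least N(N-1) in log r, N
cannot exceed S^{3/5} except on a set of finite logarithmic measure (`exists_exceptional_set`). Any
exponent strictly between 1/2 and 1 would serve. -/

theorem lintegral_pi_prod_eq_prod {N : ℕ} {f : Fin N → ℂ → ℝ≥0∞} (hf : ∀ i, Measurable (f i)) :
    ∫⁻ x : Fin N → ℂ, ∏ i, f i (x i) = ∏ i, ∫⁻ x, f i x := by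
  induction N with
  | zero => simp [lintegral_unique, volume_pi]
  | succ n ih =>
    have hmp := (volume_preserving_piFinSuccAbove (fun _ : Fin (n + 1) => ℂ) 0)
    have hg : Measurable fun y : Fin n → ℂ => ∏ i : Fin n, f i.succ (y i) :=
      Finset.measurable_prod _ fun i _ => (hf _).comp (measurable_pi_apply i)
    have key : ∫⁻ x : Fin (n + 1) → ℂ, ∏ i, f i (x i) =
        ∫⁻ p : ℂ × (Fin n → ℂ), f 0 p.1 * ∏ i : Fin n, f i.succ (p.2 i) := by
      have hm : Measurable fun p : ℂ × (Fin n → ℂ) => f 0 p.1 * ∏ i : Fin n, f i.succ (p.2 i) :=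
        ((hf 0).comp measurable_fst).mul (hg.comp measurable_snd)
      rw [← hmp.lintegral_comp hm]
      refine lintegral_congr fun x => ?_
      rw [Fin.prod_univ_succ]
      simp [MeasurableEquiv.piFinSuccAbove, Fin.insertNthEquiv, Fin.tail]
    rw [key, Measure.volume_eq_prod, lintegral_prod_mul (hf 0).aemeasurable hg.aemeasurable,
      ih fun i => hf i.succ, Fin.prod_univ_succ]

/-- A linear change of variables in `ℂⁿ` multiplies volumes by the squared modulus of its
determinant. -/
theorem lintegral_mulVec_add {N : ℕ} (A : Matrix (Fin N) (Fin N) ℂ) (hA : A.det ≠ 0)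
    (w : Fin N → ℂ) {F : (Fin N → ℂ) → ℝ≥0∞} (hF : Measurable F) :
    ∫⁻ x, F (A.mulVec x + w) = ENNReal.ofReal ((‖A.det‖ ^ 2)⁻¹) * ∫⁻ x, F x := by
  -- The real determinant of a complex linear map is the norm of its complex determinant from ℂ to
  -- ℝ, that is |det A|².
  have hdet : LinearMap.det ((Matrix.toLin' A).restrictScalars ℝ) = ‖A.det‖ ^ 2 := by
    rw [LinearMap.det_restrictScalars, Algebra.norm_complex_eq, LinearMap.det_toLin']
    simp [Complex.normSq_eq_norm_sq]
  have h0 : LinearMap.det ((Matrix.toLin' A).restrictScalars ℝ) ≠ 0 := by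
    rw [hdet]; positivity
  have hmap := Measure.map_linearMap_addHaar_eq_smul_addHaar
    (volume : Measure (Fin N → ℂ)) h0
  have hmeas : Measurable ((Matrix.toLin' A).restrictScalars ℝ) :=
    (LinearMap.continuous_of_finiteDimensional _).measurable
  calc ∫⁻ x, F (A.mulVec x + w)
      = ∫⁻ y, F (y + w) ∂(Measure.map ((Matrix.toLin' A).restrictScalars ℝ) volume) := by
        have hm : Measurable fun y => F (y + w) := hF.comp (measurable_id.add_const w)
        rw [lintegral_map hm hmeas]
        simp
    _ = _ := by
        rw [hmap, lintegral_smul_measure, lintegral_add_right_eq_self F w, hdet, abs_of_nonneg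
          (by positivity)]
        rfl

/-! ### The standard complex Gaussian -/

theorem stdComplexGaussian_density_measurable :
    Measurable fun z : ℂ => ENNReal.ofReal (Real.pi⁻¹ * Real.exp (-‖z‖ ^ 2)) := by fun_prop

theorem lintegral_stdComplexGaussian {f : ℂ → ℝ≥0∞} (hf : Measurable f) :
    ∫⁻ z, f z ∂stdComplexGaussian =
      ∫⁻ z, ENNReal.ofReal (Real.pi⁻¹ * Real.exp (-‖z‖ ^ 2)) * f z := by
  rw [stdComplexGaussian, lintegral_withDensity_eq_lintegral_mul _
    stdComplexGaussian_density_measurable hf]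
  rfl

/-- This one exponential moment supplies both the Gaussian tail bound, via Markov's inequality, and
the first moment bound, via |z| ≤ exp(|z|²/2). -/
theorem lintegral_exp_half_norm_sq_stdComplexGaussian :
    ∫⁻ z, ENNReal.ofReal (Real.exp (‖z‖ ^ 2 / 2)) ∂stdComplexGaussian = 2 := by
  rw [lintegral_stdComplexGaussian (by fun_prop)]
  have h1 : ∀ z : ℂ, ENNReal.ofReal (Real.pi⁻¹ * Real.exp (-‖z‖ ^ 2)) *
      ENNReal.ofReal (Real.exp (‖z‖ ^ 2 / 2)) =
      ENNReal.ofReal (Real.pi⁻¹ * Real.exp (-(1 / 2) * ‖z‖ ^ (2 : ℝ))) := fun z => by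
    rw [← ENNReal.ofReal_mul (by positivity), mul_assoc, ← Real.exp_add]
    norm_num
    ring_nf
  simp_rw [h1]
  have h2 := Complex.integral_exp_neg_mul_rpow (p := 2) (b := 1 / 2) (by norm_num) (by norm_num)
  have h3 : ∫ z : ℂ, Real.exp (-(1 / 2) * ‖z‖ ^ (2 : ℝ)) = 2 * Real.pi := by
    rw [h2]
    norm_num [Real.Gamma_two, Real.rpow_neg_one]
    ring
  have hint : Integrable fun z : ℂ => Real.exp (-(1 / 2) * ‖z‖ ^ (2 : ℝ)) := by
    by_contra h
    rw [integral_undef h] at h3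
    have := Real.pi_pos
    linarith
  rw [← ofReal_integral_eq_lintegral_ofReal (hint.const_mul _)
    (Eventually.of_forall fun z => by positivity), integral_const_mul, h3]
  field_simp
  norm_num

theorem lintegral_norm_stdComplexGaussian_le :
    ∫⁻ z, ENNReal.ofReal ‖z‖ ∂stdComplexGaussian ≤ 2 := by
  rw [← lintegral_exp_half_norm_sq_stdComplexGaussian]
  refine lintegral_mono fun z => ENNReal.ofReal_le_ofReal ?_
  nlinarith [Real.add_one_le_exp (‖z‖ ^ 2 / 2), sq_nonneg (‖z‖ - 1)]

theorem stdComplexGaussian_norm_ge_le (t : ℝ) (ht : 0 ≤ t) :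
    stdComplexGaussian {z | t ≤ ‖z‖} ≤ ENNReal.ofReal (2 * Real.exp (-t ^ 2 / 2)) := by
  have h := meas_ge_le_lintegral_div (μ := stdComplexGaussian)
    (f := fun z : ℂ => ENNReal.ofReal (Real.exp (‖z‖ ^ 2 / 2)))
    (Measurable.aemeasurable (by fun_prop)) (ε := ENNReal.ofReal (Real.exp (t ^ 2 / 2)))
    (by simp [Real.exp_pos]) ENNReal.ofReal_ne_top
  rw [lintegral_exp_half_norm_sq_stdComplexGaussian] at h
  refine (measure_mono fun z hz => ?_).trans (h.trans_eq ?_)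
  · have hz' : t ≤ ‖z‖ := hz
    exact ENNReal.ofReal_le_ofReal (Real.exp_le_exp.2 (by gcongr))
  · rw [neg_div, Real.exp_neg, ← div_eq_mul_inv, ENNReal.ofReal_div_of_pos (Real.exp_pos _)]
    simp

theorem le_stdComplexGaussian_closedBall {t : ℝ} (ht0 : 0 ≤ t) (ht1 : t ≤ 1) :
    ENNReal.ofReal (Real.exp (-1) * t ^ 2) ≤ stdComplexGaussian {z | ‖z‖ ≤ t} := by
  have hm : MeasurableSet {z : ℂ | ‖z‖ ≤ t} := measurableSet_le measurable_norm measurable_const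
  rw [stdComplexGaussian, withDensity_apply _ hm]
  have hv : volume {z : ℂ | ‖z‖ ≤ t} = ENNReal.ofReal (t ^ 2 * Real.pi) := by
    have : {z : ℂ | ‖z‖ ≤ t} = Metric.closedBall 0 t := by ext z; simp
    rw [this, Complex.volume_closedBall, ENNReal.ofReal_mul (by positivity),
      ENNReal.ofReal_pow ht0]
    congr 1
    rw [← NNReal.coe_real_pi, ENNReal.ofReal_coe_nnreal]
  calc ENNReal.ofReal (Real.exp (-1) * t ^ 2)
      = ∫⁻ _ in {z : ℂ | ‖z‖ ≤ t}, ENNReal.ofReal (Real.pi⁻¹ * Real.exp (-1)) := by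
        rw [setLIntegral_const, hv, ← ENNReal.ofReal_mul (by positivity)]
        congr 1
        field_simp
    _ ≤ _ := by
        refine setLIntegral_mono (by fun_prop) fun z hz => ENNReal.ofReal_le_ofReal ?_
        have hz' : ‖z‖ ≤ t := hz
        gcongr
        nlinarith [norm_nonneg z]

theorem stdComplexGaussian_norm_ge_pos (t : ℝ) : 0 < stdComplexGaussian {z | t ≤ ‖z‖} := by
  have hac : volume ≪ stdComplexGaussian := by
    refine withDensity_absolutelyContinuous'
      stdComplexGaussian_density_measurable.aemeasurable (Eventually.of_forall fun z => ?_)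
    simp only [ne_eq, ENNReal.ofReal_eq_zero, not_le]
    positivity
  rw [pos_iff_ne_zero]
  intro h
  have h1 := hac h
  have hsub : Metric.ball ((|t| + 1 : ℝ) : ℂ) 1 ⊆ {z : ℂ | t ≤ ‖z‖} := by
    intro z hz
    have h2 : ‖((|t| + 1 : ℝ) : ℂ)‖ ≤ ‖z‖ + dist z ((|t| + 1 : ℝ) : ℂ) := by
      rw [dist_eq_norm, norm_sub_rev]
      calc _ = ‖z + (((|t| + 1 : ℝ) : ℂ) - z)‖ := by ring_nf
        _ ≤ _ := norm_add_le _ _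
    rw [Complex.norm_real, Real.norm_of_nonneg (by positivity)] at h2
    have h3 := Metric.mem_ball.1 hz
    have := le_abs_self t
    simp only [Set.mem_ofPred_eq]
    linarith
  exact (Metric.measure_ball_pos volume _ one_pos).ne' (measure_mono_null hsub h1)

instance isProbabilityMeasure_stdComplexGaussian : IsProbabilityMeasure stdComplexGaussian := by
  constructor
  have h := lintegral_stdComplexGaussian (f := fun _ => 1) measurable_const
  simp only [lintegral_const, one_mul, mul_one] at h
  rw [h]
  have h2 := Complex.integral_exp_neg_rpow (p := 2) (by norm_num)
  have h3 : ∫ z : ℂ, Real.exp (-‖z‖ ^ 2) = Real.pi := by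
    simp only [Real.rpow_ofNat] at h2
    rw [h2]
    norm_num [Real.Gamma_two]
  have hint : Integrable fun z : ℂ => Real.exp (-‖z‖ ^ 2) := by
    by_contra h
    rw [integral_undef h] at h3
    exact Real.pi_pos.ne h3
  rw [← ofReal_integral_eq_lintegral_ofReal (hint.const_mul _)
    (Eventually.of_forall fun z => by positivity), integral_const_mul, h3]
  field_simp
  norm_num

/-- The decay of the Gaussian density is not needed in the upper bound: truncation at radius R
already makes the integrals finite, so the density may be replaced by its maximum π^{-N}. -/
theorem pi_stdComplexGaussian_le (N : ℕ) :
    Measure.pi (fun _ : Fin N => stdComplexGaussian) ≤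
      ENNReal.ofReal (Real.pi⁻¹ ^ N) • (volume : Measure (Fin N → ℂ)) := by
  set d : ℂ → ℝ≥0∞ := fun z => ENNReal.ofReal (Real.pi⁻¹ * Real.exp (-‖z‖ ^ 2)) with hd
  have hdm : Measurable d := stdComplexGaussian_density_measurable
  have hpi : Measure.pi (fun _ : Fin N => stdComplexGaussian) =
      (volume : Measure (Fin N → ℂ)).withDensity fun x => ∏ i, d (x i) := by
    refine Measure.pi_eq fun s hs => ?_
    rw [withDensity_apply _ (MeasurableSet.univ_pi hs),
      ← lintegral_indicator (MeasurableSet.univ_pi hs)]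
    have : ∀ x : Fin N → ℂ, (Set.univ.pi s).indicator (fun x => ∏ i, d (x i)) x =
        ∏ i, (s i).indicator d (x i) := fun x => by
      by_cases hx : x ∈ Set.univ.pi s
      · rw [Set.indicator_of_mem hx]
        exact Finset.prod_congr rfl fun i _ => (Set.indicator_of_mem (hx i trivial) _).symm
      · rw [Set.indicator_of_notMem hx]
        simp only [Set.mem_pi, Set.mem_univ, forall_const, not_forall] at hx
        obtain ⟨i, hi⟩ := hx
        exact (Finset.prod_eq_zero (Finset.mem_univ i) (Set.indicator_of_notMem hi _)).symm
    simp_rw [this]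
    rw [lintegral_pi_prod_eq_prod fun i => hdm.indicator (hs i)]
    refine Finset.prod_congr rfl fun i _ => ?_
    rw [lintegral_indicator (hs i), stdComplexGaussian, withDensity_apply _ (hs i)]
  rw [hpi, ← withDensity_const]
  refine withDensity_mono (Eventually.of_forall fun x => ?_)
  rw [ENNReal.ofReal_pow (by positivity)]
  calc ∏ i, d (x i) ≤ ∏ _i : Fin N, ENNReal.ofReal Real.pi⁻¹ := by
        refine Finset.prod_le_prod' fun i _ => ENNReal.ofReal_le_ofReal ?_
        refine mul_le_of_le_one_right (by positivity) (Real.exp_le_one_iff.2 ?_)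
        simp
    _ = _ := by simp

/-- The function `|ζ|^{ε-2}` on the disk of radius `R`, extended by zero. -/
noncomputable def truncatedPower (R ε : ℝ) (ζ : ℂ) : ℝ≥0∞ :=
  if ‖ζ‖ ≤ R then ENNReal.ofReal (‖ζ‖ ^ (ε - 2)) else 0

theorem measurable_truncatedPower (R ε : ℝ) : Measurable (truncatedPower R ε) := by
  refine Measurable.ite (measurableSet_le measurable_norm measurable_const) ?_ measurable_const
  fun_prop

theorem lintegral_truncatedPower {R ε : ℝ} (hR : 0 < R) (hε : 0 < ε) :
    ∫⁻ ζ, truncatedPower R ε ζ = ENNReal.ofReal (2 * Real.pi * (R ^ ε / ε)) := by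
  set f : ℝ → ℝ := (Set.Iic R).indicator fun y => y ^ (ε - 2) with hf
  have h1 : ∀ ζ : ℂ, truncatedPower R ε ζ = ENNReal.ofReal (f ‖ζ‖) := fun ζ => by
    by_cases h : ‖ζ‖ ≤ R
    · simp [truncatedPower, hf, h]
    · simp [truncatedPower, hf, h]
  have h0 : ∀ ζ : ℂ, 0 ≤ f ‖ζ‖ := fun ζ => by
    simp only [hf, Set.indicator]
    split_ifs <;> positivity
  have e1 : Set.EqOn (fun y : ℝ => y ^ (Module.finrank ℝ ℂ - 1) • f y)
      ((Set.Ioc 0 R).indicator fun y => y ^ (ε - 1)) (Set.Ioi 0) := by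
    intro y hy
    have hy' : 0 < y := hy
    by_cases h : y ≤ R
    · have : y ∈ Set.Ioc 0 R := ⟨hy, h⟩
      simp only [Complex.finrank_real_complex, hf]
      rw [Set.indicator_of_mem (show y ∈ Set.Iic R from h), Set.indicator_of_mem this]
      simp only [smul_eq_mul]
      rw [show ε - 1 = 1 + (ε - 2) by ring, Real.rpow_add hy']
      simp
    · simp [hf, h]
  have hI : IntegrableOn (fun y : ℝ => y ^ (ε - 1)) (Set.Ioc 0 R) := by
    have := intervalIntegral.intervalIntegrable_rpow' (a := 0) (b := R) (r := ε - 1) (by linarith)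
    exact (intervalIntegrable_iff_integrableOn_Ioc_of_le hR.le).1 this
  have hint : Integrable fun ζ : ℂ => f ‖ζ‖ := by
    rw [integrable_fun_norm_addHaar, integrableOn_congr_fun e1 measurableSet_Ioi]
    exact (hI.integrable_indicator measurableSet_Ioc).integrableOn
  simp_rw [h1]
  rw [← ofReal_integral_eq_lintegral_ofReal hint (Eventually.of_forall h0),
    integral_fun_norm_addHaar, setIntegral_congr_fun measurableSet_Ioi e1,
    setIntegral_indicator measurableSet_Ioc]
  have : Set.Ioi 0 ∩ Set.Ioc 0 R = Set.Ioc 0 R := by ext; simp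
  rw [this, ← intervalIntegral.integral_of_le hR.le, integral_rpow (Or.inl (by linarith))]
  congr 1
  have hb : volume.real (Metric.ball (0 : ℂ) 1) = Real.pi := by
    simp [Measure.real, Complex.volume_ball]
  rw [hb, Complex.finrank_real_complex]
  simp [hε.ne']
  ring

/-! ### Values of a random polynomial at the vertices of a regular polygon -/

noncomputable def unityRoot (N : ℕ) : ℂ := Complex.exp (2 * Real.pi * Complex.I / N)

theorem unityRoot_isPrimitiveRoot {N : ℕ} (hN : N ≠ 0) : IsPrimitiveRoot (unityRoot N) N :=
  Complex.isPrimitiveRoot_exp N hN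

theorem norm_unityRoot (N : ℕ) : ‖unityRoot N‖ = 1 := by
  rw [unityRoot, show (2 * Real.pi * Complex.I / N : ℂ) = ((2 * Real.pi / N : ℝ) : ℂ) * Complex.I by
    push_cast; ring]
  exact Complex.norm_exp_ofReal_mul_I _

/-- The rows of the Fourier matrix U are orthogonal of squared length N, so U U* = N·I; take
determinants. -/
theorem norm_det_fourier_sq (N : ℕ) :
    ‖(Matrix.of fun j n : Fin N => (unityRoot N ^ (j : ℕ)) ^ (n : ℕ)).det‖ ^ 2 = (N : ℝ) ^ N := by
  rcases eq_or_ne N 0 with rfl | hN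
  · simp
  set U := Matrix.of fun j n : Fin N => (unityRoot N ^ (j : ℕ)) ^ (n : ℕ) with hU
  have hprim := unityRoot_isPrimitiveRoot hN
  have hconj : unityRoot N * (starRingEnd ℂ) (unityRoot N) = 1 := by
    rw [Complex.mul_conj, Complex.normSq_eq_norm_sq, norm_unityRoot]; simp
  have hmul : U * U.conjTranspose = (N : ℂ) • (1 : Matrix (Fin N) (Fin N) ℂ) := by
    ext j k
    have hentry : (U * U.conjTranspose) j k = ∑ n ∈ Finset.range N,
        (unityRoot N ^ (j : ℕ) * (starRingEnd ℂ) (unityRoot N) ^ (k : ℕ)) ^ n := by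
      rw [Matrix.mul_apply, ← Fin.sum_univ_eq_sum_range
        (fun n => (unityRoot N ^ (j : ℕ) * (starRingEnd ℂ) (unityRoot N) ^ (k : ℕ)) ^ n)]
      refine Finset.sum_congr rfl fun n _ => ?_
      simp [hU, mul_pow]
    rw [hentry]
    have hk : unityRoot N ^ (k : ℕ) * (starRingEnd ℂ) (unityRoot N) ^ (k : ℕ) = 1 := by
      rw [← mul_pow, hconj, one_pow]
    by_cases hjk : j = k
    · subst hjk
      simp [hk]
    · set x := unityRoot N ^ (j : ℕ) * (starRingEnd ℂ) (unityRoot N) ^ (k : ℕ) with hx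
      have hx1 : x ≠ 1 := fun h => by
        apply hjk
        have h2 : unityRoot N ^ (j : ℕ) = unityRoot N ^ (k : ℕ) := by
          calc unityRoot N ^ (j : ℕ) = x * unityRoot N ^ (k : ℕ) := by
                rw [hx, mul_assoc, mul_comm ((starRingEnd ℂ) _ ^ _), hk, mul_one]
            _ = _ := by rw [h, one_mul]
        exact Fin.ext (hprim.pow_inj j.2 k.2 h2)
      have hxN : x ^ N = 1 := by
        rw [hx, mul_pow, ← pow_mul, ← pow_mul, mul_comm, mul_comm (j : ℕ), mul_comm (k : ℕ),
          pow_mul, pow_mul, hprim.pow_eq_one, ← map_pow, hprim.pow_eq_one]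
        simp
      have := mul_geom_sum x N
      rw [hxN, sub_self, mul_eq_zero] at this
      rw [this.resolve_left (sub_ne_zero.2 hx1)]
      simp [hjk]
  have hdet := congrArg Matrix.det hmul
  rw [Matrix.det_mul, Matrix.det_conjTranspose, Matrix.det_smul, Matrix.det_one] at hdet
  have h3 := congrArg norm hdet
  rw [norm_mul, norm_star] at h3
  rw [sq, h3]
  simp

theorem norm_det_vandermonde_scaled (N : ℕ) (a : ℕ → ℝ) (ζ : ℂ) :
    ∏ n : Fin N, (a n * ‖ζ‖ ^ (n : ℕ)) ^ 2 ≤ ‖(Matrix.of fun j n : Fin N =>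
      (a n : ℂ) * (ζ * unityRoot N ^ (j : ℕ)) ^ (n : ℕ)).det‖ ^ 2 := by
  have hfac : (Matrix.of fun j n : Fin N => (a n : ℂ) * (ζ * unityRoot N ^ (j : ℕ)) ^ (n : ℕ)) =
      (Matrix.of fun j n : Fin N => (unityRoot N ^ (j : ℕ)) ^ (n : ℕ)) *
        Matrix.diagonal fun n : Fin N => (a n : ℂ) * ζ ^ (n : ℕ) := by
    ext j n
    rw [Matrix.mul_diagonal]
    simp [mul_pow]
    ring
  rw [hfac, Matrix.det_mul, Matrix.det_diagonal, norm_mul, mul_pow, norm_det_fourier_sq]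
  have hone : (1 : ℝ) ≤ (N : ℝ) ^ N := by
    rcases eq_or_ne N 0 with rfl | hN
    · simp
    · exact one_le_pow₀ (by exact_mod_cast Nat.one_le_iff_ne_zero.2 hN)
  rw [norm_prod, ← Finset.prod_pow]
  simp only [norm_mul, norm_pow, Complex.norm_real, Real.norm_eq_abs, mul_pow, sq_abs]
  exact le_mul_of_one_le_left (Finset.prod_nonneg fun i _ => by positivity) hone

/-- The vertex values are A x + w, with A the Fourier matrix times the diagonal matrix of a_n ζ^n.
Changing variables decouples the product into one-dimensional integrals. By translation invariance
the bound does not depend on w, which will be the contribution of the higher coefficients. -/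
theorem lintegral_prod_truncatedPower_le {N : ℕ} {a : ℕ → ℝ} (ha : ∀ n, 0 < a n) {ζ : ℂ}
    (hζ : ζ ≠ 0) (w : Fin N → ℂ) {R ε : ℝ} (hR : 0 < R) (hε : 0 < ε) :
    ∫⁻ x, ∏ j : Fin N, truncatedPower R ε
      (∑ n : Fin N, x n * (a n : ℂ) * (ζ * unityRoot N ^ (j : ℕ)) ^ (n : ℕ) + w j)
        ∂(Measure.pi fun _ : Fin N => stdComplexGaussian) ≤
    ENNReal.ofReal ((2 * (R ^ ε / ε)) ^ N * (∏ n : Fin N, (a n * ‖ζ‖ ^ (n : ℕ)) ^ 2)⁻¹) := by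
  set A := Matrix.of fun j n : Fin N => (a n : ℂ) * (ζ * unityRoot N ^ (j : ℕ)) ^ (n : ℕ) with hA
  have hz : 0 < ‖ζ‖ := norm_pos_iff.2 hζ
  have hprod : 0 < ∏ n : Fin N, (a n * ‖ζ‖ ^ (n : ℕ)) ^ 2 :=
    Finset.prod_pos fun n _ => by have := ha n; positivity
  have hle := norm_det_vandermonde_scaled N a ζ
  rw [← hA] at hle
  have hdet : A.det ≠ 0 := fun h => by
    rw [h] at hle
    simp only [norm_zero, ne_eq, OfNat.ofNat_ne_zero, not_false_eq_true, zero_pow] at hle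
    linarith
  have hF : Measurable fun y : Fin N → ℂ => ∏ j, truncatedPower R ε (y j) :=
    Finset.measurable_prod _ fun j _ =>
      (measurable_truncatedPower R ε).comp (measurable_pi_apply j)
  have hcongr : ∀ x : Fin N → ℂ, ∏ j : Fin N, truncatedPower R ε
      (∑ n : Fin N, x n * (a n : ℂ) * (ζ * unityRoot N ^ (j : ℕ)) ^ (n : ℕ) + w j) =
      ∏ j, truncatedPower R ε ((A.mulVec x + w) j) := fun x => by
    refine Finset.prod_congr rfl fun j _ => ?_
    congr 1
    simp only [Pi.add_apply, Matrix.mulVec, dotProduct, hA, Matrix.of_apply]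
    congr 1
    exact Finset.sum_congr rfl fun n _ => by ring
  simp_rw [hcongr]
  refine (lintegral_mono' (pi_stdComplexGaussian_le N) le_rfl).trans ?_
  rw [lintegral_smul_measure, lintegral_mulVec_add A hdet w hF,
    lintegral_pi_prod_eq_prod fun _ => measurable_truncatedPower R ε, Finset.prod_const,
    lintegral_truncatedPower hR hε, Finset.card_univ, Fintype.card_fin, smul_eq_mul,
    ← ENNReal.ofReal_pow (by positivity), ← ENNReal.ofReal_mul (by positivity),
    ← ENNReal.ofReal_mul (by positivity)]
  refine ENNReal.ofReal_le_ofReal ?_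
  have hpi : Real.pi⁻¹ ^ N * (2 * Real.pi * (R ^ ε / ε)) ^ N = (2 * (R ^ ε / ε)) ^ N := by
    rw [← mul_pow]
    congr 1
    field_simp
  rw [mul_comm (‖A.det‖ ^ 2)⁻¹, ← mul_assoc, hpi]
  gcongr

/-! ### The mean value property for functions without zeros -/

/-- Harmonicity of log|f| fixes the mean of the sum over the vertices, and convexity of exp turns
this into a lower bound. The hypothesis on R makes the truncation invisible. -/
theorem rpow_norm_le_lintegral_prod_truncatedPower {f : ℂ → ℂ} {ρ : ℝ} (hρ : 0 < ρ)
    (hf : AnalyticOnNhd ℂ f (Metric.closedBall 0 ρ)) (hf0 : ∀ z ∈ Metric.closedBall 0 ρ, f z ≠ 0)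
    {R : ℝ} (hR : ∀ z, ‖z‖ = ρ → ‖f z‖ ≤ R) (N : ℕ) (ε : ℝ) :
    ENNReal.ofReal (2 * Real.pi * ‖f 0‖ ^ ((ε - 2) * N)) ≤
      ∫⁻ θ in Set.Ioc 0 (2 * Real.pi), ∏ j : Fin N, truncatedPower R ε
        (f (circleMap 0 ρ θ * unityRoot N ^ (j : ℕ))) := by
  have hnorm : ∀ (θ : ℝ) (j : ℕ), ‖circleMap 0 ρ θ * unityRoot N ^ j‖ = ρ := fun θ j => by
    rw [norm_mul, norm_pow, norm_unityRoot, one_pow, mul_one, norm_circleMap_zero,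
      abs_of_pos hρ]
  have hmem : ∀ (θ : ℝ) (j : ℕ), circleMap 0 ρ θ * unityRoot N ^ j ∈ Metric.closedBall (0 : ℂ) ρ :=
    fun θ j => by rw [mem_closedBall_zero_iff, hnorm]
  have hpos : ∀ (θ : ℝ) (j : ℕ), 0 < ‖f (circleMap 0 ρ θ * unityRoot N ^ j)‖ := fun θ j =>
    norm_pos_iff.2 (hf0 _ (hmem θ j))
  have hcont : ∀ j : ℕ, Continuous fun θ : ℝ =>
      Real.log ‖f (circleMap 0 ρ θ * unityRoot N ^ j)‖ := fun j => by
    refine Continuous.log ?_ fun θ => (hpos θ j).ne'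
    refine Continuous.norm ?_
    exact hf.continuousOn.comp_continuous ((continuous_circleMap 0 ρ).mul continuous_const)
      fun θ => hmem θ j
  have hmean : ∀ j : ℕ, ∫ θ in 0..2 * Real.pi,
      Real.log ‖f (circleMap 0 ρ θ * unityRoot N ^ j)‖ = 2 * Real.pi * Real.log ‖f 0‖ :=
    fun j => by
      have hmaps : ∀ z ∈ Metric.closedBall (0 : ℂ) |ρ|,
          z * unityRoot N ^ j ∈ Metric.closedBall (0 : ℂ) ρ := fun z hz => by
        rw [mem_closedBall_zero_iff, abs_of_pos hρ] at hz
        rwa [mem_closedBall_zero_iff, norm_mul, norm_pow, norm_unityRoot, one_pow, mul_one]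
      have h := AnalyticOnNhd.circleAverage_log_norm_of_ne_zero (R := ρ) (c := 0)
        (g := fun z => f (z * unityRoot N ^ j))
        (fun z hz => AnalyticAt.fun_comp (f := fun z => z * unityRoot N ^ j) (hf _ (hmaps z hz))
          (by fun_prop))
        (fun z hz => hf0 _ (hmaps z hz))
      rw [Real.circleAverage_def, zero_mul, smul_eq_mul] at h
      rw [← h, ← mul_assoc, mul_inv_cancel₀ (by positivity), one_mul]
  set u : ℝ → ℝ := fun θ => ∑ j : Fin N,
    Real.log ‖f (circleMap 0 ρ θ * unityRoot N ^ (j : ℕ))‖ with hu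
  have hucont : Continuous u := continuous_finsetSum _ fun j _ => hcont j
  have huint : ∫ θ in 0..2 * Real.pi, u θ = 2 * Real.pi * (N * Real.log ‖f 0‖) := by
    simp only [hu]
    rw [intervalIntegral.integral_finsetSum fun (j : Fin N) _ =>
      (hcont j).intervalIntegrable _ _]
    simp [hmean]
    ring
  have hprod : ∀ θ, ∏ j : Fin N, truncatedPower R ε
      (f (circleMap 0 ρ θ * unityRoot N ^ (j : ℕ))) = ENNReal.ofReal (Real.exp ((ε - 2) * u θ)) :=
    fun θ => by
      rw [hu, Finset.mul_sum, Real.exp_sum, ENNReal.ofReal_prod_of_nonneg fun j _ =>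
        (Real.exp_pos _).le]
      refine Finset.prod_congr rfl fun j _ => ?_
      rw [truncatedPower, if_pos (hR _ (hnorm θ j)), Real.rpow_def_of_pos (hpos θ j), mul_comm]
  simp_rw [hprod]
  have hecont : Continuous fun θ => Real.exp ((ε - 2) * u θ) := by fun_prop
  have h2pi : (0 : ℝ) ≤ 2 * Real.pi := by positivity
  rw [← ofReal_integral_eq_lintegral_ofReal ((intervalIntegrable_iff_integrableOn_Ioc_of_le
    h2pi).1 (hecont.intervalIntegrable _ _)) (Eventually.of_forall fun θ => (Real.exp_pos _).le),
    ← intervalIntegral.integral_of_le h2pi]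
  refine ENNReal.ofReal_le_ofReal ?_
  have hf00 : 0 < ‖f 0‖ := norm_pos_iff.2 (hf0 0 (by simp [hρ.le]))
  set c := (ε - 2) * (N * Real.log ‖f 0‖) with hc
  have hexp : ‖f 0‖ ^ ((ε - 2) * N) = Real.exp c := by
    rw [Real.rpow_def_of_pos hf00, hc]
    ring_nf
  -- Jensen's inequality through the tangent line of exp at c, the mean of (ε - 2) u: the tangent
  -- line integrates to exactly 2π exp c.
  have hlow : ∫ θ in 0..2 * Real.pi, Real.exp c * (1 - c + (ε - 2) * u θ) =
      2 * Real.pi * Real.exp c := by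
    rw [intervalIntegral.integral_const_mul, intervalIntegral.integral_add
      (by simp) ((hucont.const_mul _).intervalIntegrable _ _),
      intervalIntegral.integral_const_mul, huint, intervalIntegral.integral_const, hc]
    simp only [sub_zero, smul_eq_mul]
    ring
  rw [hexp, ← hlow]
  refine intervalIntegral.integral_mono h2pi (Continuous.intervalIntegrable (by fun_prop) _ _)
    (hecont.intervalIntegrable _ _) fun θ => ?_
  have h1 := Real.add_one_le_exp ((ε - 2) * u θ - c)
  calc Real.exp c * (1 - c + (ε - 2) * u θ) ≤ Real.exp c * Real.exp ((ε - 2) * u θ - c) := by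
        gcongr
        linarith
    _ = _ := by rw [← Real.exp_add]; ring_nf

/-! ### Absolute convergence of the random series -/

/-- The sum `∑ |x_n| a_n r^n`. -/
noncomputable def absSeries (a : ℕ → ℝ) (r : ℝ) (x : ℕ → ℂ) : ℝ≥0∞ :=
  ∑' n, ENNReal.ofReal (‖x n‖ * (a n * r ^ n))

theorem measurable_absSeries (a : ℕ → ℝ) (r : ℝ) : Measurable (absSeries a r) := by
  unfold absSeries
  fun_prop

theorem summable_of_absSeries_ne_top {a : ℕ → ℝ} (ha : ∀ n, 0 < a n) {r : ℝ} (hr : 0 ≤ r)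
    {x : ℕ → ℂ} (h : absSeries a r x ≠ ⊤) : Summable fun n => ‖x n‖ * (a n * r ^ n) := by
  have h1 := ENNReal.summable_toReal h
  refine h1.congr fun n => ENNReal.toReal_ofReal ?_
  have := ha n
  positivity

theorem ofReal_tsum_eq_absSeries {a : ℕ → ℝ} (ha : ∀ n, 0 < a n) {r : ℝ} (hr : 0 ≤ r)
    {x : ℕ → ℂ} (h : absSeries a r x ≠ ⊤) :
    ENNReal.ofReal (∑' n, ‖x n‖ * (a n * r ^ n)) = absSeries a r x :=
  ENNReal.ofReal_tsum_of_nonneg (fun n => by have := ha n; positivity)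
    (summable_of_absSeries_ne_top ha hr h)

theorem norm_gaussianSeries_term_le {a : ℕ → ℝ} (ha : ∀ n, 0 < a n) {r : ℝ} (x : ℕ → ℂ) {z : ℂ}
    (hz : ‖z‖ ≤ r) (n : ℕ) : ‖x n * (a n : ℂ) * z ^ n‖ ≤ ‖x n‖ * (a n * r ^ n) := by
  rw [norm_mul, norm_mul, norm_pow, Complex.norm_real, Real.norm_of_nonneg (ha n).le, mul_assoc]
  have := ha n
  gcongr

theorem summable_gaussianSeries {a : ℕ → ℝ} (ha : ∀ n, 0 < a n) {r : ℝ} {x : ℕ → ℂ} {z : ℂ}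
    (hz : ‖z‖ ≤ r) (h : absSeries a r x ≠ ⊤) : Summable fun n => x n * (a n : ℂ) * z ^ n :=
  Summable.of_norm_bounded (summable_of_absSeries_ne_top ha ((norm_nonneg z).trans hz) h)
    (norm_gaussianSeries_term_le ha x hz)

theorem norm_gaussianSeries_le {a : ℕ → ℝ} (ha : ∀ n, 0 < a n) {r : ℝ} {x : ℕ → ℂ} {z : ℂ}
    (hz : ‖z‖ ≤ r) (h : absSeries a r x ≠ ⊤) :
    ‖gaussianSeries a x z‖ ≤ ∑' n, ‖x n‖ * (a n * r ^ n) :=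
  tsum_of_norm_bounded (summable_of_absSeries_ne_top ha ((norm_nonneg z).trans hz) h).hasSum
    (norm_gaussianSeries_term_le ha x hz)

theorem analyticOnNhd_gaussianSeries {a : ℕ → ℝ} (ha : ∀ n, 0 < a n) {r : ℝ} (hr : 0 ≤ r)
    {x : ℕ → ℂ} (h : absSeries a r x ≠ ⊤) :
    AnalyticOnNhd ℂ (gaussianSeries a x) (Metric.ball 0 r) := by
  refine DifferentiableOn.analyticOnNhd ?_ Metric.isOpen_ball
  refine Complex.differentiableOn_tsum_of_summable_norm (summable_of_absSeries_ne_top ha hr h)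
    (fun n => by fun_prop) Metric.isOpen_ball fun n z hz => ?_
  exact norm_gaussianSeries_term_le ha x (mem_ball_zero_iff.1 hz).le n

theorem gaussianSeries_zero (a : ℕ → ℝ) (x : ℕ → ℂ) : gaussianSeries a x 0 = x 0 * a 0 := by
  rw [gaussianSeries, tsum_eq_single 0 fun n hn => by simp [hn]]
  simp

/-! ### Independence of the first coefficients and the others -/

section Indep

variable {Ω : Type*} [MeasurableSpace Ω] {P : Measure Ω} {φ : ℕ → Ω → ℂ}

theorem indepFun_head_tail (hm : ∀ n, Measurable (φ n)) (hind : iIndepFun φ P) (N : ℕ) :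
    IndepFun (fun ω (i : Fin N) => φ i ω) (fun ω (k : ℕ) => φ (N + k) ω) P := by
  have h := indep_iSup_of_disjoint (fun n => (hm n).comap_le) hind
    (S := Set.Iio N) (T := Set.Ici N) (Set.disjoint_left.2 fun n h1 h2 => by
      simp only [Set.mem_Iio, Set.mem_Ici] at h1 h2; omega)
  refine indep_of_indep_of_le_left (indep_of_indep_of_le_right h ?_) ?_
  · rw [MeasurableSpace.pi, MeasurableSpace.comap_iSup]
    refine iSup_le fun k => ?_
    rw [MeasurableSpace.comap_comp]
    exact le_iSup₂_of_le (N + k) (by simp) le_rfl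
  · rw [MeasurableSpace.pi, MeasurableSpace.comap_iSup]
    refine iSup_le fun i => ?_
    rw [MeasurableSpace.comap_comp]
    exact le_iSup₂_of_le (i : ℕ) (by simp) le_rfl

theorem map_head_eq_pi [IsProbabilityMeasure P] (hm : ∀ n, Measurable (φ n)) (hind : iIndepFun φ P)
    (hlaw : ∀ n, P.map (φ n) = stdComplexGaussian) (N : ℕ) :
    P.map (fun ω (i : Fin N) => φ i ω) = Measure.pi fun _ => stdComplexGaussian := by
  have h := hind.precomp (g := fun i : Fin N => (i : ℕ)) Fin.val_injective
  rw [iIndepFun_iff_map_fun_eq_pi_map fun i => (hm _).aemeasurable] at h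
  rw [h]
  simp [hlaw]

theorem lintegral_absSeries_le (hm : ∀ n, Measurable (φ n))
    (hlaw : ∀ n, P.map (φ n) = stdComplexGaussian) {a : ℕ → ℝ} (ha : ∀ n, 0 < a n) {r : ℝ}
    (hr : 0 ≤ r) (hs : Summable fun n => a n * r ^ n) :
    ∫⁻ ω, absSeries a r (fun n => φ n ω) ∂P ≤ ENNReal.ofReal (2 * ∑' n, a n * r ^ n) := by
  unfold absSeries
  rw [lintegral_tsum fun n => by
    have := hm n
    exact Measurable.aemeasurable (by fun_prop)]
  rw [← tsum_mul_left, ENNReal.ofReal_tsum_of_nonneg (fun n => by have := ha n; positivity)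
    (hs.mul_left 2)]
  refine ENNReal.tsum_le_tsum fun n => ?_
  have hn : 0 ≤ a n * r ^ n := by have := ha n; positivity
  have hmn := hm n
  simp_rw [ENNReal.ofReal_mul (norm_nonneg _)]
  rw [lintegral_mul_const _ (by fun_prop), ENNReal.ofReal_mul zero_le_two]
  gcongr
  rw [← lintegral_map (f := fun z : ℂ => ENNReal.ofReal ‖z‖) (by fun_prop) hmn, hlaw]
  simpa using lintegral_norm_stdComplexGaussian_le

/-! ### The upper bound for the hole probability -/

/-- The sum of the terms of index at least `N`, with coefficients `y`, set to be zero where it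
does not converge absolutely. -/
noncomputable def tailSeries (a : ℕ → ℝ) (N : ℕ) (r : ℝ) (y : ℕ → ℂ) (z : ℂ) : ℂ :=
  if absSeries (fun k => a (N + k) * r ^ N) r y ≠ ⊤ then
    ∑' k, y k * (a (N + k) : ℂ) * z ^ (N + k) else 0

theorem measurable_tailSeries {a : ℕ → ℝ} (ha : ∀ n, 0 < a n) {N : ℕ} {r : ℝ} (hr : 0 < r)
    {α : Type*} [MeasurableSpace α] {Y : α → ℕ → ℂ} (hY : Measurable Y) {z : α → ℂ}
    (hz : Measurable z) (hzr : ∀ t, ‖z t‖ ≤ r) :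
    Measurable fun t => tailSeries a N r (Y t) (z t) := by
  set D : Set α := {t | absSeries (fun k => a (N + k) * r ^ N) r (Y t) ≠ ⊤} with hD
  have hDm : MeasurableSet D :=
    (((measurable_absSeries _ r).comp hY) (measurableSet_singleton ⊤)).compl
  have hYk : ∀ k, Measurable fun t => Y t k := fun k => (measurable_pi_apply k).comp hY
  refine measurable_of_tendsto_metrizable (f := fun K t => D.indicator (fun t =>
    ∑ k ∈ Finset.range K, Y t k * (a (N + k) : ℂ) * z t ^ (N + k)) t) (fun K => ?_) ?_
  · refine Measurable.indicator ?_ hDm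
    refine Finset.measurable_sum _ fun k _ => ?_
    exact ((hYk k).mul_const _).mul (hz.pow_const _)
  · rw [tendsto_pi_nhds]
    intro t
    by_cases ht : t ∈ D
    · simp only [Set.indicator_of_mem ht]
      rw [tailSeries, if_pos (show absSeries _ _ _ ≠ ⊤ from ht)]
      refine Summable.tendsto_sum_tsum_nat ?_
      have h1 := summable_gaussianSeries (a := fun k => a (N + k) * r ^ N)
        (fun k => by have := ha (N + k); positivity) (hzr t) ht
      refine (h1.mul_right (z t ^ N / (r : ℂ) ^ N)).congr fun k => ?_
      have : (r : ℂ) ≠ 0 := by exact_mod_cast hr.ne'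
      push_cast
      field_simp
      ring
    · simp only [Set.indicator_of_notMem ht]
      rw [tailSeries, if_neg (show ¬ absSeries _ _ _ ≠ ⊤ from ht)]
      exact tendsto_const_nhds

theorem gaussianSeries_eq_head_add_tail {a : ℕ → ℝ} (ha : ∀ n, 0 < a n) (N : ℕ) {r : ℝ}
    {x : ℕ → ℂ} {z : ℂ} (hz : ‖z‖ ≤ r) (h : absSeries a r x ≠ ⊤) :
    gaussianSeries a x z = ∑ n : Fin N, x n * (a n : ℂ) * z ^ (n : ℕ) +
      tailSeries a N r (fun k => x (N + k)) z := by
  have htail : absSeries (fun k => a (N + k) * r ^ N) r (fun k => x (N + k)) ≠ ⊤ := by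
    refine ne_top_of_le_ne_top h ?_
    have h1 := ENNReal.tsum_comp_le_tsum_of_injective (add_right_injective N)
      (fun n => ENNReal.ofReal (‖x n‖ * (a n * r ^ n)))
    refine le_trans (le_of_eq ?_) h1
    refine tsum_congr fun k => ?_
    congr 2
    ring
  rw [tailSeries, if_pos htail, gaussianSeries,
    ← (summable_gaussianSeries ha hz h).sum_add_tsum_nat_add N,
    Fin.sum_univ_eq_sum_range (fun n => x n * (a n : ℂ) * z ^ n) N]
  simp only [add_comm N]

/-- The vertices of a regular polygon with `N` vertices on the circle of radius `ρ`. -/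
noncomputable def polygonVertex (N : ℕ) (ρ θ : ℝ) (j : ℕ) : ℂ :=
  circleMap 0 ρ θ * unityRoot N ^ j

theorem norm_polygonVertex (N : ℕ) {ρ : ℝ} (hρ : 0 ≤ ρ) (θ : ℝ) (j : ℕ) :
    ‖polygonVertex N ρ θ j‖ = ρ := by
  rw [polygonVertex, norm_mul, norm_pow, norm_unityRoot, one_pow, mul_one, norm_circleMap_zero,
    abs_of_nonneg hρ]

theorem continuous_polygonVertex (N : ℕ) (ρ : ℝ) (j : ℕ) :
    Continuous fun θ => polygonVertex N ρ θ j :=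
  (continuous_circleMap 0 ρ).mul continuous_const

/-- The product of the truncated powers of the values of the series at the vertices of a polygon,
as a function of the first `N` coefficients and of the others. -/
noncomputable def polygonKernel (a : ℕ → ℝ) (N : ℕ) (r ρ R ε θ : ℝ)
    (p : (Fin N → ℂ) × (ℕ → ℂ)) : ℝ≥0∞ :=
  ∏ j : Fin N, truncatedPower R ε
    (∑ n : Fin N, p.1 n * (a n : ℂ) * polygonVertex N ρ θ j ^ (n : ℕ) +
      tailSeries a N r p.2 (polygonVertex N ρ θ j))

theorem measurable_polygonKernel {a : ℕ → ℝ} (ha : ∀ n, 0 < a n) {r ρ : ℝ} (hr : 0 < r)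
    (hρ : 0 ≤ ρ) (hρr : ρ ≤ r) (N : ℕ) (R ε : ℝ) :
    Measurable fun q : ((Fin N → ℂ) × (ℕ → ℂ)) × ℝ => polygonKernel a N r ρ R ε q.2 q.1 := by
  refine Finset.measurable_prod _ fun j _ => (measurable_truncatedPower R ε).comp ?_
  refine Measurable.add (Finset.measurable_sum _ fun n _ => ?_) ?_
  · have h1 : Measurable fun q : ((Fin N → ℂ) × (ℕ → ℂ)) × ℝ => q.1.1 n :=
      (measurable_pi_apply n).comp (measurable_fst.comp measurable_fst)
    exact (h1.mul_const _).mul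
      (((continuous_polygonVertex N ρ j).measurable.comp measurable_snd).pow_const _)
  · exact measurable_tailSeries ha hr (measurable_snd.comp measurable_fst)
      ((continuous_polygonVertex N ρ j).measurable.comp measurable_snd)
      fun q => (norm_polygonVertex N hρ _ _).le.trans hρr

/-- A hole forces a large |f(0)|, a large absolute sum, or a large polygon average; the three
summands bound these cases. The radius ρ < r is used because f is known to be analytic and zero-free
only on the open disk. -/
theorem measure_holeEvent_le_of_radius_lt [IsProbabilityMeasure P] (hm : ∀ n, Measurable (φ n)) (hind : iIndepFun φ P)
    (hlaw : ∀ n, P.map (φ n) = stdComplexGaussian) {a : ℕ → ℝ} (ha : ∀ n, 0 < a n) (N : ℕ)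
    {r ρ R ε A : ℝ} (hρ : 0 < ρ) (hρr : ρ < r) (hR : 0 < R) (hε : 0 < ε) (hε2 : ε ≤ 2)
    (hA : 0 < A) :
    P (holeEvent a φ r) ≤ P {ω | A ≤ ‖φ 0 ω‖ * a 0} +
      P {ω | ENNReal.ofReal R ≤ absSeries a r fun n => φ n ω} +
      ENNReal.ofReal (A ^ ((2 - ε) * N) * ((2 * (R ^ ε / ε)) ^ N *
        (∏ n : Fin N, (a n * ρ ^ (n : ℕ)) ^ 2)⁻¹)) := by
  have hr : 0 < r := hρ.trans hρr
  have hzn := norm_polygonVertex N hρ.le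
  set X : Ω → Fin N → ℂ := fun ω i => φ i ω with hX
  set Y : Ω → ℕ → ℂ := fun ω k => φ (N + k) ω with hY
  have hXm : Measurable X := measurable_pi_iff.2 fun i => hm _
  have hYm : Measurable Y := measurable_pi_iff.2 fun i => hm _
  obtain ⟨K, hK⟩ : ∃ K, K = polygonKernel a N r ρ R ε := ⟨_, rfl⟩
  have hKm : Measurable fun q : ((Fin N → ℂ) × (ℕ → ℂ)) × ℝ => K q.2 q.1 :=
    hK ▸ measurable_polygonKernel ha hr hρ.le hρr.le N R ε
  set C := ENNReal.ofReal ((2 * (R ^ ε / ε)) ^ N *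
    (∏ n : Fin N, (a n * ρ ^ (n : ℕ)) ^ 2)⁻¹) with hC
  have hEK : ∀ θ, ∫⁻ ω, K θ (X ω, Y ω) ∂P ≤ C := fun θ => by
    have hKθ : Measurable (K θ) := hKm.comp (measurable_prodMk_right (y := θ))
    rw [← lintegral_map hKθ (hXm.prodMk hYm), hK, (indepFun_iff_map_prod_eq_prod_map_map
      hXm.aemeasurable hYm.aemeasurable).1 (indepFun_head_tail hm hind N),
      map_head_eq_pi hm hind hlaw N]
    have : IsProbabilityMeasure (P.map Y) := Measure.isProbabilityMeasure_map hYm.aemeasurable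
    rw [lintegral_prod_symm _ (hK ▸ hKθ).aemeasurable]
    -- For frozen higher coefficients y, the inner integral is over the first N coefficients only,
    -- and its bound C is uniform in y.
    calc _ ≤ ∫⁻ _, C ∂(P.map Y) := by
          refine lintegral_mono fun y => ?_
          have hzθ : circleMap 0 ρ θ ≠ 0 := norm_pos_iff.1 (by
            rw [norm_circleMap_zero, abs_of_pos hρ]; exact hρ)
          have h := lintegral_prod_truncatedPower_le ha hzθ
            (fun j : Fin N => tailSeries a N r y (polygonVertex N ρ θ j)) hR hε
          rw [norm_circleMap_zero, abs_of_pos hρ] at h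
          exact h
      _ = C := by simp
  set G : Ω → ℝ≥0∞ := fun ω => ∫⁻ θ in Set.Ioc 0 (2 * Real.pi), K θ (X ω, Y ω) with hG
  have hKΩ : Measurable (Function.uncurry fun ω θ => K θ (X ω, Y ω)) :=
    hKm.comp (((hXm.prodMk hYm).comp measurable_fst).prodMk measurable_snd)
  have hGm : Measurable G := hKΩ.lintegral_prod_right
  have hEG : ∫⁻ ω, G ω ∂P ≤ ENNReal.ofReal (2 * Real.pi) * C := by
    rw [hG, lintegral_lintegral_swap hKΩ.aemeasurable]
    calc _ ≤ ∫⁻ _ in Set.Ioc 0 (2 * Real.pi), C := lintegral_mono fun θ => hEK θ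
      _ = _ := by rw [setLIntegral_const, Real.volume_Ioc, sub_zero, mul_comm]
  -- The level follows from |f(0)| < A, since the exponent (ε - 2) N is nonpositive.
  set B := 2 * Real.pi * A ^ ((ε - 2) * N) with hB
  have hBpos : 0 < B := by positivity
  have hsub : holeEvent a φ r ⊆ ({ω | A ≤ ‖φ 0 ω‖ * a 0} ∪
      {ω | ENNReal.ofReal R ≤ absSeries a r fun n => φ n ω}) ∪ {ω | ENNReal.ofReal B ≤ G ω} := by
    intro ω hω
    by_cases h1 : A ≤ ‖φ 0 ω‖ * a 0
    · exact Or.inl (Or.inl h1)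
    by_cases h2 : ENNReal.ofReal R ≤ absSeries a r fun n => φ n ω
    · exact Or.inl (Or.inr h2)
    right
    push Not at h1 h2
    have hfin := h2.ne_top
    have hbd : ∀ w : ℂ, ‖w‖ = ρ → ‖gaussianSeries a (fun n => φ n ω) w‖ ≤ R := fun w hw => by
      refine (norm_gaussianSeries_le ha (hw.le.trans hρr.le) hfin).trans ?_
      rw [← ofReal_tsum_eq_absSeries ha hr.le hfin] at h2
      exact ((ENNReal.ofReal_lt_ofReal_iff hR).1 h2).le
    have hball : Metric.closedBall (0 : ℂ) ρ ⊆ Metric.ball 0 r := Metric.closedBall_subset_ball hρr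
    have h := rpow_norm_le_lintegral_prod_truncatedPower hρ
      ((analyticOnNhd_gaussianSeries ha hr.le hfin).mono hball)
      (fun w hw => hω w (mem_ball_zero_iff.1 (hball hw))) hbd N ε
    have hG' : G ω = ∫⁻ θ in Set.Ioc 0 (2 * Real.pi), ∏ j : Fin N, truncatedPower R ε
        (gaussianSeries a (fun n => φ n ω) (circleMap 0 ρ θ * unityRoot N ^ (j : ℕ))) := by
      rw [hG, hK]
      refine lintegral_congr fun θ => Finset.prod_congr rfl fun j _ => ?_
      change _ = truncatedPower R ε (gaussianSeries a _ (polygonVertex N ρ θ j))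
      rw [gaussianSeries_eq_head_add_tail ha N ((hzn θ j).le.trans hρr.le) hfin]
    change ENNReal.ofReal B ≤ G ω
    rw [hG']
    refine le_trans (ENNReal.ofReal_le_ofReal ?_) h
    rw [hB]
    have h00 : 0 < ‖gaussianSeries a (fun n => φ n ω) 0‖ :=
      norm_pos_iff.2 (hω 0 (by simpa using hr))
    have h0A : ‖gaussianSeries a (fun n => φ n ω) 0‖ ≤ A := by
      rw [gaussianSeries_zero, norm_mul, Complex.norm_real, Real.norm_of_nonneg (ha 0).le]
      exact h1.le
    refine mul_le_mul_of_nonneg_left ?_ (by positivity)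
    exact Real.rpow_le_rpow_of_nonpos h00 h0A
      (mul_nonpos_of_nonpos_of_nonneg (by linarith) (Nat.cast_nonneg N))
  refine (measure_mono hsub).trans ((measure_union_le _ _).trans ?_)
  refine add_le_add (measure_union_le _ _) ?_
  have hmk := meas_ge_le_lintegral_div (μ := P) hGm.aemeasurable
    (ε := ENNReal.ofReal B) (by simpa using hBpos) ENNReal.ofReal_ne_top
  refine hmk.trans ?_
  refine (ENNReal.div_le_div_right hEG _).trans_eq ?_
  rw [hC, ← ENNReal.ofReal_mul (by positivity), ← ENNReal.ofReal_div_of_pos hBpos]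
  congr 1
  rw [hB, show (2 - ε) * (N : ℝ) = -((ε - 2) * N) by ring, Real.rpow_neg hA.le]
  field_simp

end Indep

section HoleBounds

variable {Ω : Type*} [MeasurableSpace Ω] {P : Measure Ω} {φ : ℕ → Ω → ℂ}

theorem measure_holeEvent_le [IsProbabilityMeasure P] (hm : ∀ n, Measurable (φ n))
    (hind : iIndepFun φ P)
    (hlaw : ∀ n, P.map (φ n) = stdComplexGaussian) {a : ℕ → ℝ} (ha : ∀ n, 0 < a n) (N : ℕ)
    {r R ε A : ℝ} (hr : 0 < r) (hR : 0 < R) (hε : 0 < ε) (hε2 : ε ≤ 2)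
    (hA : 0 < A) :
    P (holeEvent a φ r) ≤ P {ω | A ≤ ‖φ 0 ω‖ * a 0} +
      P {ω | ENNReal.ofReal R ≤ absSeries a r fun n => φ n ω} +
      ENNReal.ofReal (A ^ ((2 - ε) * N) * ((2 * (R ^ ε / ε)) ^ N *
        (∏ n : Fin N, (a n * r ^ (n : ℕ)) ^ 2)⁻¹)) := by
  -- Only the last summand depends on ρ, so one may let ρ increase to r.
  have hcont : ContinuousAt (fun ρ : ℝ => ENNReal.ofReal (A ^ ((2 - ε) * N) *
      ((2 * (R ^ ε / ε)) ^ N * (∏ n : Fin N, (a n * ρ ^ (n : ℕ)) ^ 2)⁻¹))) r := by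
    refine ENNReal.continuous_ofReal.continuousAt.comp ?_
    refine continuousAt_const.mul (continuousAt_const.mul (ContinuousAt.inv₀ ?_ ?_))
    · fun_prop
    · exact (Finset.prod_pos fun n _ => by have := ha n; positivity).ne'
  have hlim : Tendsto (fun ρ : ℝ => P {ω | A ≤ ‖φ 0 ω‖ * a 0} +
      P {ω | ENNReal.ofReal R ≤ absSeries a r fun n => φ n ω} + ENNReal.ofReal (A ^ ((2 - ε) * N) *
      ((2 * (R ^ ε / ε)) ^ N * (∏ n : Fin N, (a n * ρ ^ (n : ℕ)) ^ 2)⁻¹))) (𝓝[<] r) (𝓝 _) :=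
    (hcont.tendsto.mono_left nhdsWithin_le_nhds).const_add _
  refine ge_of_tendsto hlim ?_
  filter_upwards [Ioo_mem_nhdsLT hr] with ρ hρ
  exact measure_holeEvent_le_of_radius_lt hm hind hlaw ha N hρ.1 hρ.2 hR hε hε2 hA

/-! ### The lower bound for the hole probability -/

/-- The m middle terms contribute at most m/(m+1) ≤ 1 and the tail less than 1/2, which cannot
cancel a constant term of modulus at least 2. -/
theorem ne_zero_of_dominant_constant_term {a : ℕ → ℝ} (ha : ∀ n, 0 < a n) {r : ℝ} (hr : 0 < r)
    (m : ℕ) {x : ℕ → ℂ} (h0 : 2 ≤ ‖x 0‖ * a 0)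
    (hmid : ∀ n < m, ‖x (n + 1)‖ * (a (n + 1) * r ^ (n + 1)) ≤ 1 / (m + 1))
    (htail : ∑' k, ENNReal.ofReal (‖x (m + 1 + k)‖ * (a (m + 1 + k) * r ^ (m + 1 + k))) <
      ENNReal.ofReal (1 / 2)) {z : ℂ} (hz : ‖z‖ ≤ r) : gaussianSeries a x z ≠ 0 := by
  have hshift : ∑' k, ENNReal.ofReal (‖x (k + (m + 1))‖ * (a (k + (m + 1)) * r ^ (k + (m + 1)))) ≠
      ⊤ := by
    refine ne_top_of_le_ne_top htail.ne_top (le_of_eq (tsum_congr fun k => ?_))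
    rw [add_comm k (m + 1)]
  have hfin : absSeries a r x ≠ ⊤ := by
    rw [absSeries, ← Summable.sum_add_tsum_nat_add' (f := fun n =>
      ENNReal.ofReal (‖x n‖ * (a n * r ^ n))) (k := m + 1) ENNReal.summable]
    exact ENNReal.add_ne_top.2 ⟨ENNReal.sum_ne_top.2 fun _ _ => ENNReal.ofReal_ne_top, hshift⟩
  have hsum := summable_of_absSeries_ne_top ha hr.le hfin
  have hsum' : Summable fun k => ‖x (m + 1 + k)‖ * (a (m + 1 + k) * r ^ (m + 1 + k)) := by
    simpa only [add_comm] using (summable_nat_add_iff (m + 1)).2 hsum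
  have htail' : ∑' k, ‖x (m + 1 + k)‖ * (a (m + 1 + k) * r ^ (m + 1 + k)) < 1 / 2 := by
    rw [← ENNReal.ofReal_tsum_of_nonneg
      (fun k => by have := ha (m + 1 + k); positivity) hsum'] at htail
    exact (ENNReal.ofReal_lt_ofReal_iff (by norm_num)).1 htail
  intro hzero
  rw [gaussianSeries, ← (summable_gaussianSeries ha hz hfin).sum_add_tsum_nat_add (m + 1),
    Finset.sum_range_succ'] at hzero
  simp only [add_comm _ (m + 1), pow_zero, mul_one] at hzero
  set s1 := ∑ n ∈ Finset.range m, x (n + 1) * (a (n + 1) : ℂ) * z ^ (n + 1) with hs1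
  set s2 := ∑' k, x (m + 1 + k) * (a (m + 1 + k) : ℂ) * z ^ (m + 1 + k) with hs2
  have hs1' : ‖s1‖ ≤ 1 := by
    calc ‖s1‖ ≤ ∑ _n ∈ Finset.range m, (1 / (m + 1) : ℝ) := norm_sum_le_of_le _ fun n hn =>
          (norm_gaussianSeries_term_le ha x hz (n + 1)).trans (hmid n (Finset.mem_range.1 hn))
      _ ≤ 1 := by
          rw [Finset.sum_const, Finset.card_range, nsmul_eq_mul, mul_one_div, div_le_one
            (by positivity)]
          linarith
  have hs2' : ‖s2‖ < 1 / 2 := lt_of_le_of_lt (tsum_of_norm_bounded hsum'.hasSum fun k =>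
    norm_gaussianSeries_term_le ha x hz (m + 1 + k)) htail'
  have h0' : ‖x 0 * (a 0 : ℂ)‖ = ‖x 0‖ * a 0 := by
    rw [norm_mul, Complex.norm_real, Real.norm_of_nonneg (ha 0).le]
  have h3 : x 0 * (a 0 : ℂ) = -(s1 + s2) := by linear_combination hzero
  rw [h3, norm_neg] at h0'
  have := norm_add_le s1 s2
  linarith

theorem half_le_measure_tail [IsProbabilityMeasure P] (hm : ∀ n, Measurable (φ n))
    (hlaw : ∀ n, P.map (φ n) = stdComplexGaussian) {a : ℕ → ℝ} (ha : ∀ n, 0 < a n) {r : ℝ}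
    (hr : 0 < r) (m : ℕ) (hs : Summable fun n => a n * r ^ n)
    (htail : ∑' k, a (m + k) * r ^ (m + k) ≤ 1 / 8) :
    1 / 2 ≤ P {ω | ∑' k, ENNReal.ofReal (‖φ (m + k) ω‖ * (a (m + k) * r ^ (m + k))) <
      ENNReal.ofReal (1 / 2)} := by
  set F : Ω → ℝ≥0∞ := fun ω => ∑' k, ENNReal.ofReal (‖φ (m + k) ω‖ * (a (m + k) * r ^ (m + k)))
    with hF
  have heq : ∀ ω, F ω = absSeries (fun k => a (m + k) * r ^ m) r fun k => φ (m + k) ω := fun ω =>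
    tsum_congr fun k => by congr 2; ring
  have hFm : Measurable F := by
    have : Measurable fun ω => fun k => φ (m + k) ω := measurable_pi_iff.2 fun k => hm _
    rw [funext heq]
    exact (measurable_absSeries (fun k => a (m + k) * r ^ m) r).comp this
  have hs' : Summable fun k => a (m + k) * r ^ m * r ^ k := by
    refine ((summable_nat_add_iff m).2 hs).congr fun k => ?_
    rw [add_comm k, pow_add]
    ring
  -- The factor 2 is the bound for E|φ_n|. Markov's inequality at level 1/2 then gives probability
  -- at most 1/2.
  have hE : ∫⁻ ω, F ω ∂P ≤ ENNReal.ofReal (1 / 4) := by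
    have h := lintegral_absSeries_le (fun k => hm (m + k)) (fun k => hlaw (m + k))
      (a := fun k => a (m + k) * r ^ m) (fun k => by have := ha (m + k); positivity) hr.le hs'
    simp_rw [heq]
    refine h.trans (ENNReal.ofReal_le_ofReal ?_)
    have : ∑' k, a (m + k) * r ^ m * r ^ k = ∑' k, a (m + k) * r ^ (m + k) :=
      tsum_congr fun k => by ring
    rw [this]
    linarith
  have hmk := meas_ge_le_lintegral_div (μ := P) hFm.aemeasurable
    (ε := ENNReal.ofReal (1 / 2)) (by simp) ENNReal.ofReal_ne_top
  have hc : P {ω | F ω < ENNReal.ofReal (1 / 2)}ᶜ ≤ 1 / 2 := by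
    have : {ω | F ω < ENNReal.ofReal (1 / 2)}ᶜ = {ω | ENNReal.ofReal (1 / 2) ≤ F ω} := by
      ext; simp
    rw [this]
    refine hmk.trans ((ENNReal.div_le_div_right hE _).trans_eq ?_)
    rw [← ENNReal.ofReal_div_of_pos (by norm_num)]
    norm_num
    rw [ENNReal.ofReal_div_of_pos (by norm_num)]
    simp
  have hadd := prob_add_prob_compl (μ := P) (measurableSet_lt hFm measurable_const :
    MeasurableSet {ω | F ω < ENNReal.ofReal (1 / 2)})
  by_contra! hlt
  have := ENNReal.add_lt_add_of_lt_of_le (by finiteness) hlt hc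
  rw [hadd, ENNReal.add_halves] at this
  exact lt_irrefl _ this

theorem le_measure_holeEvent [IsProbabilityMeasure P] (hm : ∀ n, Measurable (φ n))
    (hind : iIndepFun φ P) (hlaw : ∀ n, P.map (φ n) = stdComplexGaussian) {a : ℕ → ℝ}
    (ha : ∀ n, 0 < a n) {r : ℝ} (hr : 0 < r) (m : ℕ) (hs : Summable fun n => a n * r ^ n)
    (htail : ∑' k, a (m + 1 + k) * r ^ (m + 1 + k) ≤ 1 / 8) :
    stdComplexGaussian {z | 2 / a 0 ≤ ‖z‖} * (∏ n : Fin m, ENNReal.ofReal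
      (Real.exp (-1) * (1 / ((m + 1) * max 1 (a (n + 1) * r ^ ((n : ℕ) + 1)))) ^ 2)) * (1 / 2) ≤
    P (holeEvent a φ r) := by
  set X : Ω → Fin (m + 1) → ℂ := fun ω i => φ i ω with hX
  set Y : Ω → ℕ → ℂ := fun ω k => φ (m + 1 + k) ω with hY
  have hXm : Measurable X := measurable_pi_iff.2 fun i => hm _
  have hYm : Measurable Y := measurable_pi_iff.2 fun i => hm _
  set D : Fin (m + 1) → Set ℂ := Fin.cons {z | 2 / a 0 ≤ ‖z‖} fun n : Fin m =>
    {z | ‖z‖ ≤ 1 / ((m + 1) * max 1 (a (n + 1) * r ^ ((n : ℕ) + 1)))} with hD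
  have hDm : ∀ i, MeasurableSet (D i) := fun i => by
    refine Fin.cases ?_ (fun n => ?_) i
    · exact measurableSet_le measurable_const measurable_norm
    · exact measurableSet_le measurable_norm measurable_const
  set T : Set (ℕ → ℂ) := {y | ∑' k, ENNReal.ofReal (‖y k‖ * (a (m + 1 + k) * r ^ (m + 1 + k))) <
    ENNReal.ofReal (1 / 2)} with hT
  have hTm : MeasurableSet T := measurableSet_lt (by fun_prop) measurable_const
  have hhalf : 1 / 2 ≤ P (Y ⁻¹' T) := half_le_measure_tail hm hlaw ha hr (m + 1) hs htail
  have hPX : P (X ⁻¹' Set.univ.pi D) = stdComplexGaussian {z | 2 / a 0 ≤ ‖z‖} *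
      ∏ n : Fin m, stdComplexGaussian
        {z | ‖z‖ ≤ 1 / ((m + 1) * max 1 (a (n + 1) * r ^ ((n : ℕ) + 1)))} := by
    rw [← Measure.map_apply hXm (MeasurableSet.univ_pi hDm), map_head_eq_pi hm hind hlaw (m + 1),
      Measure.pi_pi, Fin.prod_univ_succ]
    rfl
  have hinter := (indepFun_head_tail hm hind (m + 1)).measure_inter_preimage_eq_mul
    (Set.univ.pi D) T (MeasurableSet.univ_pi hDm) hTm
  have hsub : X ⁻¹' Set.univ.pi D ∩ Y ⁻¹' T ⊆ holeEvent a φ r := by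
    rintro ω ⟨hωX, hωY⟩ z hz
    refine ne_zero_of_dominant_constant_term ha hr m (x := fun n => φ n ω) ?_ ?_ hωY hz.le
    · have h0 : 2 / a 0 ≤ ‖φ 0 ω‖ := hωX 0 trivial
      exact (div_le_iff₀ (ha 0)).1 h0
    · intro n hn
      have h1 : ‖φ (n + 1) ω‖ ≤ 1 / ((m + 1) * max 1 (a (n + 1) * r ^ (n + 1))) :=
        hωX (Fin.succ ⟨n, hn⟩) trivial
      have hb : 0 < a (n + 1) * r ^ (n + 1) := by have := ha (n + 1); positivity
      calc ‖φ (n + 1) ω‖ * (a (n + 1) * r ^ (n + 1))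
          ≤ 1 / ((m + 1) * max 1 (a (n + 1) * r ^ (n + 1))) * max 1 (a (n + 1) * r ^ (n + 1)) := by
            gcongr
            exact le_max_right _ _
        _ = 1 / (m + 1) := by
            have : 0 < max 1 (a (n + 1) * r ^ (n + 1)) := lt_max_of_lt_left one_pos
            field_simp
  refine le_trans ?_ (measure_mono hsub)
  rw [hinter, hPX]
  refine mul_le_mul' (mul_le_mul' le_rfl (Finset.prod_le_prod' fun n _ => ?_)) hhalf
  refine le_stdComplexGaussian_closedBall (by positivity) ?_
  have h1 : (1 : ℝ) ≤ max 1 (a (n + 1) * r ^ ((n : ℕ) + 1)) := le_max_left _ _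
  rw [div_le_one (by positivity)]
  have h2 : (1 : ℝ) ≤ m + 1 := by simp
  exact one_le_mul_of_one_le_of_one_le h2 h1

end HoleBounds

/-! ### Log-concave sequences -/

/-- The logarithm of `a_n r^n`. -/
noncomputable def logTerm (a : ℕ → ℝ) (r : ℝ) (n : ℕ) : ℝ := Real.log (a n * r ^ n)

/-- The first index from which on `a_n r^n < 1`. -/
noncomputable def cutoff (a : ℕ → ℝ) (r : ℝ) : ℕ := sInf {N | ∀ n ≥ N, a n * r ^ n < 1}

/-- The three-point form of log-concavity of a sequence. -/
def LogConcaveSeq (a : ℕ → ℝ) : Prop :=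
  ∀ x y z : ℕ, x < y → y < z →
    (Real.log (a z) - Real.log (a y)) * (y - x) ≤ (Real.log (a y) - Real.log (a x)) * (z - y)

section Sequence

variable {a : ℕ → ℝ}

theorem logTerm_eq (ha : ∀ n, 0 < a n) {r : ℝ} (hr : 0 < r) (n : ℕ) :
    logTerm a r n = Real.log (a n) + n * Real.log r := by
  rw [logTerm, Real.log_mul (ha n).ne' (by positivity), Real.log_pow]

theorem exp_logTerm (ha : ∀ n, 0 < a n) {r : ℝ} (hr : 0 < r) (n : ℕ) :
    Real.exp (logTerm a r n) = a n * r ^ n :=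
  Real.exp_log (by have := ha n; positivity)

theorem logTerm_concave (ha : ∀ n, 0 < a n) (hc : LogConcaveSeq a) {r : ℝ} (hr : 0 < r)
    {x y z : ℕ} (hxy : x < y) (hyz : y < z) :
    (logTerm a r z - logTerm a r y) * (y - x) ≤ (logTerm a r y - logTerm a r x) * (z - y) := by
  simp only [logTerm_eq ha hr]
  have := hc x y z hxy hyz
  linear_combination this

theorem cutoff_spec (ha : ∀ n, 0 < a n)
    (hl : Tendsto (fun n : ℕ => Real.log (a n) / n) atTop atBot) {r : ℝ} (hr : 0 < r) :
    ∀ n ≥ cutoff a r, a n * r ^ n < 1 := by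
  have hne : {N | ∀ n ≥ N, a n * r ^ n < 1}.Nonempty := by
    have h1 := (hl.eventually (eventually_lt_atBot (-Real.log r))).and (eventually_gt_atTop 0)
    obtain ⟨N, hN⟩ := eventually_atTop.1 h1
    refine ⟨N, fun n hn => ?_⟩
    obtain ⟨h2, h3⟩ := hN n hn
    have hn0 : (0 : ℝ) < n := by exact_mod_cast h3
    rw [div_lt_iff₀ hn0] at h2
    have h4 : logTerm a r n < 0 := by rw [logTerm_eq ha hr]; linarith
    rw [← exp_logTerm ha hr]
    exact Real.exp_lt_one_iff.2 h4
  exact Nat.sInf_mem hne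

theorem lt_cutoff (ha : ∀ n, 0 < a n)
    (hl : Tendsto (fun n : ℕ => Real.log (a n) / n) atTop atBot) {r : ℝ} (hr : 0 < r) {n : ℕ}
    (hn : 1 ≤ a n * r ^ n) : n < cutoff a r := by
  by_contra! h
  exact absurd (cutoff_spec ha hl hr n h) (not_lt.2 hn)

theorem holeExponent_eq_sum (ha : ∀ n, 0 < a n)
    (hl : Tendsto (fun n : ℕ => Real.log (a n) / n) atTop atBot) {r : ℝ} (hr : 0 < r) {K : ℕ}
    (hK : cutoff a r ≤ K) :
    holeExponent a r = 2 * ∑ n ∈ Finset.range K, max (logTerm a r n) 0 := by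
  rw [holeExponent]
  congr 1
  rw [finsum_mem_eq_sum_of_subset (s := significantIndices a r)
    (t := (Finset.range K).filter fun n => 1 ≤ a n * r ^ n), Finset.sum_filter]
  · refine Finset.sum_congr rfl fun n _ => ?_
    have hb : 0 < a n * r ^ n := by have := ha n; positivity
    split_ifs with h
    · exact (max_eq_left (Real.log_nonneg h)).symm
    · exact (max_eq_right (Real.log_nonpos hb.le (not_le.1 h).le)).symm
  · rintro n ⟨hn, -⟩
    simp only [Finset.coe_filter, Finset.mem_range, Set.mem_ofPred_eq]
    exact ⟨(lt_cutoff ha hl hr hn).trans_le hK, hn⟩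
  · intro n hn
    simp only [Finset.coe_filter, Finset.mem_range, Set.mem_ofPred_eq] at hn
    exact hn.2

variable (ha : ∀ n, 0 < a n) (hc : LogConcaveSeq a)
  (hl : Tendsto (fun n : ℕ => Real.log (a n) / n) atTop atBot)

include ha in
theorem one_le_logTerm_one {r : ℝ} (hr : max 1 (Real.exp 1 / a 1) ≤ r) : 1 ≤ logTerm a r 1 := by
  have h1 : Real.exp 1 / a 1 ≤ r := (le_max_right _ _).trans hr
  rw [div_le_iff₀ (ha 1)] at h1
  rw [logTerm, Real.le_log_iff_exp_le (by
    have := ha 1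
    have : 0 < r := lt_of_lt_of_le one_pos ((le_max_left _ _).trans hr)
    positivity)]
  linarith

include ha hl in
theorem two_le_cutoff {r : ℝ} (hr : max 1 (Real.exp 1 / a 1) ≤ r) : 2 ≤ cutoff a r := by
  have hr0 : 0 < r := lt_of_lt_of_le one_pos ((le_max_left _ _).trans hr)
  refine lt_cutoff ha hl hr0 ?_
  rw [← exp_logTerm ha hr0]
  exact Real.one_le_exp (zero_le_one.trans (one_le_logTerm_one ha hr))

include ha hc in
-- The lower bound on r makes log(a_1 r) ≥ 1, and some index k ≥ n has a nonnegative logarithm; a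
-- concave sequence cannot be negative in between. Index 0 is excluded because a_0 may be less than
-- 1.
theorem logTerm_nonneg_of_lt_cutoff {r : ℝ} (hr : max 1 (Real.exp 1 / a 1) ≤ r) {n : ℕ}
    (hn1 : 1 ≤ n) (hn : n < cutoff a r) : 0 ≤ logTerm a r n := by
  have hr0 : 0 < r := lt_of_lt_of_le one_pos ((le_max_left _ _).trans hr)
  have h1 := one_le_logTerm_one ha hr
  obtain ⟨k, hk⟩ : ∃ k ≥ n, 1 ≤ a k * r ^ k := by
    by_contra! h
    exact absurd (Nat.sInf_le (s := {N | ∀ n ≥ N, a n * r ^ n < 1}) h) (not_le.2 hn)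
  have hLk : 0 ≤ logTerm a r k := Real.log_nonneg hk.2
  rcases hk.1.eq_or_lt with rfl | hnk
  · exact hLk
  rcases hn1.eq_or_lt with rfl | h1n
  · linarith
  have h := logTerm_concave ha hc hr0 h1n hnk
  by_contra! hneg
  have h1n' : (1 : ℝ) < n := by exact_mod_cast h1n
  have hnk' : (n : ℝ) < k := by exact_mod_cast hnk
  push_cast at h
  nlinarith

include ha hl in
theorem two_mul_logTerm_one_le_holeExponent {r : ℝ} (hr : max 1 (Real.exp 1 / a 1) ≤ r) :
    2 * logTerm a r 1 ≤ holeExponent a r := by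
  have hr0 : 0 < r := lt_of_lt_of_le one_pos ((le_max_left _ _).trans hr)
  rw [holeExponent_eq_sum ha hl hr0 le_rfl]
  have h := Finset.single_le_sum (f := fun n => max (logTerm a r n) 0)
    (fun n _ => le_max_right _ _) (Finset.mem_range.2 (two_le_cutoff ha hl hr))
  have h1 := le_max_left (logTerm a r 1) 0
  linarith

include ha hl in
theorem tendsto_holeExponent : Tendsto (holeExponent a) atTop atTop := by
  have h : Tendsto (fun r => 2 * (Real.log (a 1) + Real.log r)) atTop atTop :=
    (tendsto_atTop_add_const_left _ _ Real.tendsto_log_atTop).const_mul_atTop two_pos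
  refine tendsto_atTop_mono' _ ?_ h
  filter_upwards [eventually_ge_atTop (max 1 (Real.exp 1 / a 1))] with r hr
  have hr0 : 0 < r := lt_of_lt_of_le one_pos ((le_max_left _ _).trans hr)
  have h2 := two_mul_logTerm_one_le_holeExponent ha hl hr
  rw [logTerm_eq ha hr0] at h2
  simpa using h2

include ha hc hl in
-- Each term with 1 ≤ n < N stays nonnegative and gains n (log t - log r), and 2 ∑_{n<N} n = N(N-1).
-- Further terms that become significant only help.
theorem holeExponent_growth {r t : ℝ} (hr : max 1 (Real.exp 1 / a 1) ≤ r) (hrt : r ≤ t) :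
    holeExponent a r + (Real.log t - Real.log r) * (cutoff a r * (cutoff a r - 1)) ≤
      holeExponent a t := by
  have hr0 : 0 < r := lt_of_lt_of_le one_pos ((le_max_left _ _).trans hr)
  have ht0 : 0 < t := hr0.trans_le hrt
  have hlog : 0 ≤ Real.log t - Real.log r := sub_nonneg.2 (Real.log_le_log hr0 hrt)
  set N := cutoff a r with hN
  have hsum : 2 * ∑ n ∈ Finset.range N, (n : ℝ) = N * (N - 1) := by
    have hN1 : 1 ≤ N := one_le_two.trans (two_le_cutoff ha hl hr)
    have h := Finset.sum_range_id_mul_two N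
    have h' := congrArg (Nat.cast (R := ℝ)) h
    push_cast [Nat.cast_sub hN1] at h'
    linarith
  calc holeExponent a r + (Real.log t - Real.log r) * (N * (N - 1))
      = 2 * ∑ n ∈ Finset.range N, (max (logTerm a r n) 0 + n * (Real.log t - Real.log r)) := by
        rw [holeExponent_eq_sum ha hl hr0 le_rfl, ← hsum, Finset.sum_add_distrib, ← Finset.sum_mul]
        ring
    _ ≤ 2 * ∑ n ∈ Finset.range N, max (logTerm a t n) 0 := by
        gcongr with n hn
        rcases Nat.eq_zero_or_pos n with rfl | hn1
        · simp [logTerm]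
        · have h0 := logTerm_nonneg_of_lt_cutoff ha hc hr hn1 (Finset.mem_range.1 hn)
          rw [max_eq_left h0]
          refine le_trans (le_of_eq ?_) (le_max_left _ _)
          rw [logTerm_eq ha hr0, logTerm_eq ha ht0]
          ring
    _ ≤ 2 * ∑ n ∈ Finset.range (max N (cutoff a t)), max (logTerm a t n) 0 := by
        refine mul_le_mul_of_nonneg_left (Finset.sum_le_sum_of_subset_of_nonneg
          (Finset.range_mono (le_max_left _ _)) fun _ _ _ => le_max_right _ _) zero_le_two
    _ = _ := (holeExponent_eq_sum ha hl ht0 (le_max_right _ _)).symm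

/-! ### The exceptional set -/

theorem lintegral_one_div_Icc {c d : ℝ} (hc : 0 < c) (hcd : c ≤ d) :
    ∫⁻ t in Set.Icc c d, ENNReal.ofReal (1 / t) = ENNReal.ofReal (Real.log d - Real.log c) := by
  have hd : 0 < d := hc.trans_le hcd
  have hint : IntervalIntegrable (fun t : ℝ => 1 / t) volume c d :=
    intervalIntegral.intervalIntegrable_one_div (fun x hx => by
      rw [Set.uIcc_of_le hcd] at hx
      exact (hc.trans_le hx.1).ne') continuousOn_id
  rw [setLIntegral_congr Ioc_ae_eq_Icc.symm, ← ofReal_integral_eq_lintegral_ofReal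
    ((intervalIntegrable_iff_integrableOn_Ioc_of_le hcd).1 hint), ←
    intervalIntegral.integral_of_le hcd, integral_one_div_of_pos hc hd,
    Real.log_div hd.ne' hc.ne']
  rw [EventuallyLE, ae_restrict_iff' measurableSet_Ioc]
  exact Eventually.of_forall fun t ht => one_div_nonneg.2 (hc.trans ht.1).le

/-- An interval of logarithmic half-width δ around any point of B covers B, so the measurability of
B itself plays no role. -/
theorem lintegral_one_div_of_log_close (B : Set ℝ) (δ : ℝ) (hδ : 0 ≤ δ) (hB : ∀ r ∈ B, 0 < r)
    (h : ∀ r ∈ B, ∀ t ∈ B, r ≤ t → Real.log t - Real.log r ≤ δ) :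
    ∃ F, MeasurableSet F ∧ B ⊆ F ∧
      ∫⁻ t in F, ENNReal.ofReal (1 / t) ≤ ENNReal.ofReal (2 * δ) := by
  rcases B.eq_empty_or_nonempty with rfl | ⟨r, hr⟩
  · exact ⟨∅, MeasurableSet.empty, le_rfl, by simp⟩
  have hr0 := hB r hr
  refine ⟨Set.Icc (r * Real.exp (-δ)) (r * Real.exp δ), measurableSet_Icc, fun t ht => ?_, ?_⟩
  · have ht0 := hB t ht
    have key : |Real.log t - Real.log r| ≤ δ := by
      rw [abs_le]
      rcases le_total r t with h1 | h1
      · have := h r hr t ht h1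
        have := Real.log_le_log hr0 h1
        constructor <;> linarith
      · have := h t ht r hr h1
        have := Real.log_le_log ht0 h1
        constructor <;> linarith
    rw [abs_le] at key
    rw [← Real.exp_log hr0, ← Real.exp_add, ← Real.exp_add, ← Real.exp_log ht0, Set.mem_Icc,
      Real.exp_le_exp, Real.exp_le_exp]
    constructor <;> linarith
  · have hle : r * Real.exp (-δ) ≤ r * Real.exp δ := by gcongr; linarith
    rw [lintegral_one_div_Icc (by positivity) hle, Real.log_mul hr0.ne' (Real.exp_ne_zero _),
      Real.log_mul hr0.ne' (Real.exp_ne_zero _), Real.log_exp, Real.log_exp]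
    refine ENNReal.ofReal_le_ofReal ?_
    linarith

include ha hc hl in
-- The bad radii are split by dyadic size of S. In the block S ∈ [2^j, 2^{j+1}) the exponent S can
-- grow by less than 2^j, yet it grows at rate at least N(N-1) in log r; hence the block has small
-- logarithmic diameter, and the diameters are summable.
theorem exists_exceptional_set : ∃ E : Set ℝ, HasFiniteLogMeasure E ∧
    ∀ r, max 1 (Real.exp 1 / a 1) ≤ r → r ∉ E → (cutoff a r : ℝ) ^ 5 ≤ holeExponent a r ^ 3 := by
  set B : ℕ → Set ℝ := fun j => {r | max 1 (Real.exp 1 / a 1) ≤ r ∧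
    holeExponent a r ^ 3 < (cutoff a r : ℝ) ^ 5 ∧ 2 ^ j ≤ holeExponent a r ∧
    holeExponent a r < 2 ^ (j + 1)} with hB
  have hpos : ∀ j, ∀ r ∈ B j, 0 < r := fun j r hr =>
    lt_of_lt_of_le one_pos ((le_max_left _ _).trans hr.1)
  have hclose : ∀ j, ∀ r ∈ B j, ∀ t ∈ B j, r ≤ t → Real.log t - Real.log r ≤ 2 * (8 / 9) ^ j := by
    rintro j r ⟨hr, hrN, hrj, -⟩ t ⟨-, -, -, htj⟩ hrt
    have hg := holeExponent_growth ha hc hl hr hrt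
    have hr0 : 0 < r := lt_of_lt_of_le one_pos ((le_max_left _ _).trans hr)
    have hlog : 0 ≤ Real.log t - Real.log r := sub_nonneg.2 (Real.log_le_log hr0 hrt)
    have h2 : (2 : ℝ) ≤ cutoff a r := by exact_mod_cast two_le_cutoff ha hl hr
    set N : ℝ := (cutoff a r : ℝ)
    -- On the block N^10 > S^6 ≥ 64^j, and (9/4)^5 ≤ 64. Any base above 2 would do; 9/4 leaves the
    -- ratio 2/(9/4) = 8/9.
    have hN2 : (9 / 4 : ℝ) ^ j ≤ N ^ 2 := by
      by_contra! hlt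
      have h3 : (N ^ 2) ^ 5 < ((9 / 4 : ℝ) ^ j) ^ 5 := pow_lt_pow_left₀ hlt (by positivity) (by simp)
      have h4 : ((9 / 4 : ℝ) ^ j) ^ 5 ≤ 64 ^ j := by
        rw [← pow_mul, mul_comm, pow_mul]
        gcongr
        norm_num
      have h5 : ((2 : ℝ) ^ j) ^ 3 < N ^ 5 :=
        lt_of_le_of_lt (pow_le_pow_left₀ (by positivity) hrj 3) hrN
      have h6 : (((2 : ℝ) ^ j) ^ 3) ^ 2 < (N ^ 5) ^ 2 := pow_lt_pow_left₀ h5 (by positivity) (by simp)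
      have h7 : (((2 : ℝ) ^ j) ^ 3) ^ 2 = 64 ^ j := by
        rw [← pow_mul, ← pow_mul, mul_comm, pow_mul, mul_comm]
        norm_num
      have h8 : (N ^ 5) ^ 2 = (N ^ 2) ^ 5 := by ring
      linarith
    have hNN : N ^ 2 / 2 ≤ N * (N - 1) := by nlinarith
    have h9 : (Real.log t - Real.log r) * ((9 / 4) ^ j / 2) ≤ 2 ^ j := by
      calc (Real.log t - Real.log r) * ((9 / 4) ^ j / 2)
          ≤ (Real.log t - Real.log r) * (N * (N - 1)) := by
            gcongr
            linarith
        _ ≤ 2 ^ j := by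
            rw [pow_succ] at htj
            linarith
    have h10 : (2 : ℝ) ^ j = (9 / 4) ^ j / 2 * (2 * (8 / 9) ^ j) := by
      rw [show (2 : ℝ) = 9 / 4 * (8 / 9) by norm_num, mul_pow]
      ring
    rw [h10, mul_comm] at h9
    exact le_of_mul_le_mul_left h9 (by positivity)
  choose F hFm hBF hF using fun j => lintegral_one_div_of_log_close (B j) (2 * (8 / 9) ^ j)
    (by positivity) (hpos j) (hclose j)
  refine ⟨(⋃ j, F j) ∩ Set.Ici 1, ⟨(MeasurableSet.iUnion hFm).inter measurableSet_Ici,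
    Set.inter_subset_right, ?_⟩, fun r hr hrE => ?_⟩
  · calc ∫⁻ t in (⋃ j, F j) ∩ Set.Ici 1, ENNReal.ofReal (1 / t)
        ≤ ∫⁻ t in ⋃ j, F j, ENNReal.ofReal (1 / t) := lintegral_mono_set Set.inter_subset_left
      _ ≤ ∑' j, ∫⁻ t in F j, ENNReal.ofReal (1 / t) := lintegral_iUnion_le _ _
      _ ≤ ∑' j : ℕ, ENNReal.ofReal (2 * (2 * (8 / 9) ^ j)) := ENNReal.tsum_le_tsum hF
      _ < ⊤ := by
          have hs : Summable fun j : ℕ => (2 * (2 * (8 / 9) ^ j) : ℝ) :=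
            ((summable_geometric_of_lt_one (by norm_num) (by norm_num)).mul_left 2).mul_left 2
          rw [← ENNReal.ofReal_tsum_of_nonneg (fun j => by positivity) hs]
          exact ENNReal.ofReal_lt_top
  · by_contra! hlt
    have h1 : 1 ≤ holeExponent a r := by
      have := two_mul_logTerm_one_le_holeExponent ha hl hr
      have := one_le_logTerm_one ha hr
      linarith
    obtain ⟨j, hj1, hj2⟩ := exists_nat_pow_near h1 (y := 2) one_lt_two
    exact hrE ⟨Set.mem_iUnion.2 ⟨j, hBF j ⟨hr, hlt, hj1, hj2⟩⟩, (le_max_left _ _).trans hr⟩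

/-! ### Bounds for the terms outside the exceptional set -/

include ha hl hc in
-- With μ = S/(2N), some x < N has logarithm at least the average μ, while the logarithm at N is at
-- most 0. By concavity the slope beyond N is at most -μ/N, so the logarithm is at most -μ at 2N and
-- keeps falling at that rate.
theorem term_le_geometric {r : ℝ} (hr : max 1 (Real.exp 1 / a 1) ≤ r) (k : ℕ) :
    a (2 * cutoff a r + k) * r ^ (2 * cutoff a r + k) ≤
      Real.exp (-(holeExponent a r / (2 * cutoff a r))) *
        Real.exp (-(holeExponent a r / (2 * cutoff a r) / cutoff a r)) ^ k := by
  have hr0 : 0 < r := lt_of_lt_of_le one_pos ((le_max_left _ _).trans hr)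
  have h2 := two_le_cutoff ha hl hr
  have hS : 0 < holeExponent a r := by
    have := two_mul_logTerm_one_le_holeExponent ha hl hr
    have := one_le_logTerm_one ha hr
    linarith
  have hNneg : logTerm a r (cutoff a r) ≤ 0 := by
    refine Real.log_nonpos ?_ (cutoff_spec ha hl hr0 _ le_rfl).le
    have := ha (cutoff a r)
    positivity
  have hsum := holeExponent_eq_sum ha hl hr0 le_rfl
  set N := cutoff a r with hN
  have hN0 : (0 : ℝ) < N := by exact_mod_cast (by omega : 0 < N)
  set μ := holeExponent a r / (2 * N) with hμ
  have hμ0 : 0 < μ := by positivity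
  obtain ⟨x, hx, hxμ⟩ : ∃ x ∈ Finset.range N, μ ≤ max (logTerm a r x) 0 := by
    refine Finset.exists_le_of_sum_le (f := fun _ => μ) (Finset.nonempty_range_iff.2 (by omega)) ?_
    rw [Finset.sum_const, Finset.card_range, nsmul_eq_mul, hμ, hsum]
    field_simp
    rfl
  have hLx : μ ≤ logTerm a r x := by
    rcases le_max_iff.1 hxμ with h | h
    · exact h
    · linarith
  have hxN := Finset.mem_range.1 hx
  have h := logTerm_concave ha hc hr0 hxN (show N < 2 * N + k by omega)
  have hxN' : (x : ℝ) < N := by exact_mod_cast hxN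
  have hx0 : (0 : ℝ) ≤ x := Nat.cast_nonneg x
  push_cast at h
  have hL : logTerm a r (2 * N + k) ≤ -μ - k * (μ / N) := by
    by_contra! hlt
    have e1 : -μ - k * (μ / N) = -(μ / N) * (N + k) := by field_simp; ring
    rw [e1] at hlt
    have hk : (0 : ℝ) ≤ k := Nat.cast_nonneg k
    set L := logTerm a r (2 * N + k)
    have h3 : (L - logTerm a r N) * (N - x) > -(μ / N) * (N + k) * (N - x) :=
      mul_lt_mul_of_pos_right (by linarith) (by linarith)
    have h4 : (logTerm a r N - logTerm a r x) * (2 * N + k - N) ≤ -μ * (N + k) := by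
      rw [show (2 * (N : ℝ) + k - N) = N + k by ring]
      exact mul_le_mul_of_nonneg_right (by linarith) (by positivity)
    have h5 : (μ / N) * (N + k) * (N - x) ≤ μ * (N + k) := by
      calc (μ / N) * (N + k) * (N - x) ≤ (μ / N) * (N + k) * N := by
            gcongr
            linarith
        _ = _ := by field_simp
    linarith
  rw [← exp_logTerm ha hr0, ← Real.exp_nat_mul, ← Real.exp_add, Real.exp_le_exp]
  linarith

include ha hl hc in
theorem summable_and_tail_le {r : ℝ} (hr : max 1 (Real.exp 1 / a 1) ≤ r)
    (hE : (cutoff a r : ℝ) ^ 5 ≤ holeExponent a r ^ 3) (hS : 10 ^ 6 ≤ holeExponent a r) :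
    (Summable fun n => a n * r ^ n) ∧
      ∑' k, a (2 * cutoff a r + k) * r ^ (2 * cutoff a r + k) ≤ 1 / 8 := by
  have hr0 : 0 < r := lt_of_lt_of_le one_pos ((le_max_left _ _).trans hr)
  have h2 := two_le_cutoff ha hl hr
  have hgeo := term_le_geometric ha hc hl hr
  set N := cutoff a r with hN
  have hN0 : (0 : ℝ) < N := by exact_mod_cast (by omega : 0 < N)
  have hN1 : (1 : ℝ) ≤ N := by exact_mod_cast (by omega : 1 ≤ N)
  set S := holeExponent a r
  have hS0 : 0 < S := by linarith
  set μ := S / (2 * N) with hμ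
  have hμ0 : 0 < μ := by positivity
  have hSμ : S = 2 * N * μ := by rw [hμ]; field_simp
  -- From N^5 ≤ S^3 and S = 2Nμ one gets S^2 ≤ (2μ)^5, whereas 200^5 < 10^12 ≤ S^2.
  have hμ100 : 100 ≤ μ := by
    by_contra! hlt
    have h3 : S ^ 5 ≤ (2 * μ) ^ 5 * S ^ 3 := by
      calc S ^ 5 = (2 * μ) ^ 5 * N ^ 5 := by rw [hSμ]; ring
        _ ≤ _ := by gcongr
    have h4 : S ^ 2 ≤ (2 * μ) ^ 5 := by
      have : S ^ 3 * S ^ 2 ≤ S ^ 3 * (2 * μ) ^ 5 := by linarith [show S ^ 3 * S ^ 2 = S ^ 5 by ring]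
      exact le_of_mul_le_mul_left this (by positivity)
    have h5 : (2 * μ) ^ 5 ≤ 200 ^ 5 := by gcongr; linarith
    have h6 : ((10 : ℝ) ^ 6) ^ 2 ≤ S ^ 2 := by gcongr
    norm_num at h5 h6
    linarith
  -- The geometric series costs a factor 1 + N/μ. Being polynomial in μ, it is absorbed by exp(-μ).
  have hNμ : N / μ ≤ 16 * μ ^ 2 := by
    rw [div_le_iff₀ hμ0]
    have h3 : (N : ℝ) ^ 5 ≤ (2 * N * μ) ^ 3 := by rw [← hSμ]; exact hE
    have h4 : (N : ℝ) ^ 3 * N ^ 2 ≤ N ^ 3 * (8 * μ ^ 3) := by nlinarith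
    have h5 : (N : ℝ) ^ 2 ≤ 8 * μ ^ 3 := le_of_mul_le_mul_left h4 (by positivity)
    nlinarith [pow_pos hμ0 3]
  set x := μ / N with hx
  have hx0 : 0 < x := by positivity
  have hq1 : Real.exp (-x) < 1 := Real.exp_lt_one_iff.2 (by linarith)
  have hgs := (summable_geometric_of_lt_one (Real.exp_pos (-x)).le hq1).mul_left (Real.exp (-μ))
  have hnn : ∀ k, 0 ≤ a (2 * N + k) * r ^ (2 * N + k) := fun k => by
    have := ha (2 * N + k)
    positivity
  have hst : Summable fun k => a (2 * N + k) * r ^ (2 * N + k) :=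
    Summable.of_nonneg_of_le hnn hgeo hgs
  refine ⟨(summable_nat_add_iff (2 * N)).1 (by simpa only [add_comm _ (2 * N)] using hst), ?_⟩
  refine (hst.tsum_le_tsum hgeo hgs).trans ?_
  rw [tsum_mul_left, tsum_geometric_of_lt_one (Real.exp_pos _).le hq1]
  have hinv : (1 - Real.exp (-x))⁻¹ ≤ 1 + 16 * μ ^ 2 := by
    have h3 : (1 - Real.exp (-x))⁻¹ ≤ 1 + 1 / x := by
      rw [inv_le_comm₀ (by linarith) (by positivity)]
      have h4 : Real.exp (-x) ≤ 1 / (1 + x) := by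
        rw [Real.exp_neg, ← one_div]
        exact one_div_le_one_div_of_le (by positivity) (by linarith [Real.add_one_le_exp x])
      have h5 : (1 + 1 / x)⁻¹ = 1 - 1 / (1 + x) := by field_simp; ring
      rw [h5]
      linarith
    have h4 : 1 / x = N / μ := by rw [hx]; field_simp
    linarith
  have hexp : 8 * (1 + 16 * μ ^ 2) ≤ Real.exp μ := by
    have h3 := Real.pow_div_factorial_le_exp μ hμ0.le 4
    have h4 : 8 * (1 + 16 * μ ^ 2) ≤ μ ^ 4 / (Nat.factorial 4 : ℕ) := by
      norm_num [Nat.factorial]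
      have h5 : 10000 ≤ μ ^ 2 := by nlinarith
      nlinarith
    linarith
  calc Real.exp (-μ) * (1 - Real.exp (-x))⁻¹ ≤ Real.exp (-μ) * (1 + 16 * μ ^ 2) := by gcongr
    _ ≤ Real.exp (-μ) * (Real.exp μ / 8) := by gcongr; linarith
    _ = 1 / 8 := by rw [mul_div_assoc', ← Real.exp_add]; simp

end Sequence

/-! ### Two-sided bounds outside the exceptional set -/

section Asymptotic

variable {Ω : Type*} [MeasurableSpace Ω] {P : Measure Ω} [IsProbabilityMeasure P]
  {φ : ℕ → Ω → ℂ} {a : ℕ → ℝ}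

theorem exp_le_measureReal_holeEvent (hm : ∀ n, Measurable (φ n)) (hind : iIndepFun φ P)
    (hlaw : ∀ n, P.map (φ n) = stdComplexGaussian) (ha : ∀ n, 0 < a n) (hc : LogConcaveSeq a)
    (hl : Tendsto (fun n : ℕ => Real.log (a n) / n) atTop atBot) {r : ℝ}
    (hr : max 1 (Real.exp 1 / a 1) ≤ r) (hE : (cutoff a r : ℝ) ^ 5 ≤ holeExponent a r ^ 3)
    (hS : 10 ^ 6 ≤ holeExponent a r) :
    stdComplexGaussian.real {z | 2 / a 0 ≤ ‖z‖} / 2 *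
      Real.exp (-(holeExponent a r + 2 * cutoff a r + 4 * cutoff a r * Real.log (2 * cutoff a r))) ≤
    P.real (holeEvent a φ r) := by
  have hr0 : 0 < r := lt_of_lt_of_le one_pos ((le_max_left _ _).trans hr)
  obtain ⟨hs, htail⟩ := summable_and_tail_le ha hc hl hr hE hS
  have h2 := two_le_cutoff ha hl hr
  have hsum := holeExponent_eq_sum ha hl hr0 (K := 2 * cutoff a r) (by omega)
  set N := cutoff a r
  -- The tail starts at index m + 1 = 2N, where the geometric decay is available; the terms from N
  -- to 2N contribute nothing to S.
  obtain ⟨m, hmN⟩ : ∃ m, 2 * N = m + 1 := ⟨2 * N - 1, by omega⟩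
  have hmN' : 2 * (N : ℝ) = m + 1 := by exact_mod_cast hmN
  rw [hmN] at htail hsum
  have h := le_measure_holeEvent hm hind hlaw ha hr0 m hs htail
  have hfac : ∀ n : ℕ, Real.exp (-1) * (1 / ((m + 1) * max 1 (a (n + 1) * r ^ (n + 1)))) ^ 2 =
      Real.exp (-1 - 2 * Real.log (m + 1) - 2 * max (logTerm a r (n + 1)) 0) := fun n => by
    have h1 : max 1 (a (n + 1) * r ^ (n + 1)) = Real.exp (max (logTerm a r (n + 1)) 0) := by
      rw [Real.exp_monotone.map_max, exp_logTerm ha hr0, Real.exp_zero, max_comm]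
    rw [h1, show -1 - 2 * Real.log ((m : ℝ) + 1) - 2 * max (logTerm a r (n + 1)) 0 =
      -1 + 2 * -(Real.log (m + 1) + max (logTerm a r (n + 1)) 0) by ring, Real.exp_add, two_mul,
      Real.exp_add, Real.exp_neg (_ + _), Real.exp_add, Real.exp_log (by positivity)]
    ring
  simp_rw [hfac] at h
  rw [← ENNReal.ofReal_prod_of_nonneg fun n _ => (Real.exp_pos _).le, ← Real.exp_sum,
    Fin.sum_univ_eq_sum_range (fun n =>
      -1 - 2 * Real.log ((m : ℝ) + 1) - 2 * max (logTerm a r (n + 1)) 0) m,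
    Finset.sum_sub_distrib, Finset.sum_const, Finset.card_range, ← Finset.mul_sum] at h
  have h' := ENNReal.toReal_mono (measure_ne_top P _) h
  rw [ENNReal.toReal_mul, ENNReal.toReal_mul, ENNReal.toReal_ofReal (Real.exp_pos _).le] at h'
  refine le_trans ?_ h'
  have hhalf : (1 / 2 : ℝ≥0∞).toReal = 1 / 2 := by simp
  rw [hhalf, mul_right_comm _ _ (1 / 2 : ℝ), mul_one_div, ← Measure.real]
  refine mul_le_mul_of_nonneg_left (Real.exp_le_exp.2 ?_)
    (div_nonneg measureReal_nonneg zero_le_two)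
  rw [Finset.sum_range_succ'] at hsum
  have h0 := le_max_right (logTerm a r 0) 0
  have hlog : 0 ≤ Real.log ((m : ℝ) + 1) := Real.log_nonneg (by simp)
  rw [show 4 * (N : ℝ) = 2 * (m + 1) by linarith, hmN', nsmul_eq_mul]
  nlinarith

/-- The constant in front of `S²` in the upper bound for the hole probability. -/
noncomputable def holeConstant (a : ℕ → ℝ) : ℝ := max 1 (72 * Real.exp 1 * a 0 ^ 2)

theorem measureReal_holeEvent_le (hm : ∀ n, Measurable (φ n)) (hind : iIndepFun φ P)
    (hlaw : ∀ n, P.map (φ n) = stdComplexGaussian) (ha : ∀ n, 0 < a n) (hc : LogConcaveSeq a)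
    (hl : Tendsto (fun n : ℕ => Real.log (a n) / n) atTop atBot) {r : ℝ}
    (hr : max 1 (Real.exp 1 / a 1) ≤ r) (hE : (cutoff a r : ℝ) ^ 5 ≤ holeExponent a r ^ 3)
    (hS : 10 ^ 6 ≤ holeExponent a r) (hA : 1 ≤ a 0 ^ 2 * holeExponent a r) :
    P.real (holeEvent a φ r) ≤ (3 + Real.exp (2 * max 0 (-Real.log (a 0)))) *
      ((holeConstant a * holeExponent a r ^ 2) ^ cutoff a r * Real.exp (-holeExponent a r)) := by
  have hr0 : 0 < r := lt_of_lt_of_le one_pos ((le_max_left _ _).trans hr)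
  obtain ⟨hs, htail⟩ := summable_and_tail_le ha hc hl hr hE hS
  have h2 := two_le_cutoff ha hl hr
  have hsum := holeExponent_eq_sum ha hl hr0 le_rfl
  have hnonneg := fun n => logTerm_nonneg_of_lt_cutoff ha hc hr (n := n)
  have hspec := cutoff_spec ha hl hr0
  set N := cutoff a r
  set S := holeExponent a r
  have hN1 : (1 : ℝ) ≤ N := by exact_mod_cast (by omega : 1 ≤ N)
  have hS0 : 0 < S := by linarith
  have hNS : (N : ℝ) ≤ S := by
    by_contra! hlt
    have h3 : S ^ 5 < N ^ 5 := pow_lt_pow_left₀ hlt hS0.le (by simp)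
    have h4 : S ^ 3 ≤ S ^ 5 := pow_le_pow_right₀ (by linarith) (by norm_num)
    linarith
  have ha0 := ha 0
  have hterm : ∀ n, a n * r ^ n ≤ Real.exp S := fun n => by
    rcases lt_or_ge n N with hn | hn
    · rw [← exp_logTerm ha hr0, Real.exp_le_exp]
      have h3 := Finset.single_le_sum (f := fun n => max (logTerm a r n) 0)
        (fun n _ => le_max_right _ _) (Finset.mem_range.2 hn)
      have h4 := le_max_left (logTerm a r n) 0
      linarith
    · exact (hspec n hn).le.trans (Real.one_le_exp hS0.le)
  have hM : ∑' n, a n * r ^ n ≤ (2 * N + 1) * Real.exp S := by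
    rw [← hs.sum_add_tsum_nat_add (2 * N)]
    have h3 : ∑ n ∈ Finset.range (2 * N), a n * r ^ n ≤ 2 * N * Real.exp S := by
      refine (Finset.sum_le_card_nsmul _ _ _ fun n _ => hterm n).trans_eq ?_
      simp
    simp only [add_comm _ (2 * N)]
    have h4 := Real.one_le_exp hS0.le
    linarith
  -- The mean of the absolute sum is at most 2(2N+1) e^S, so exceeding R has probability at most
  -- e^{-2S}, while log R stays O(S).
  set R := 2 * (2 * N + 1) * Real.exp (3 * S) with hR
  have hR0 : 0 < R := by positivity
  have hlogR : Real.log R ≤ 9 * S := by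
    rw [hR, Real.log_mul (by positivity) (Real.exp_ne_zero _), Real.log_exp]
    have h3 := Real.log_le_sub_one_of_pos (show (0 : ℝ) < 2 * (2 * N + 1) by positivity)
    linarith
  have hlogR1 : 1 ≤ Real.log R := by
    rw [hR, Real.log_mul (by positivity) (Real.exp_ne_zero _), Real.log_exp]
    have h3 : 0 ≤ Real.log (2 * (2 * N + 1)) := Real.log_nonneg (by linarith)
    linarith
  -- This makes R^ε = e, so each vertex costs only a factor of order log R.
  set ε := 1 / Real.log R with hε
  have hε0 : 0 < ε := by positivity
  have hε1 : ε ≤ 1 := by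
    rw [hε, div_le_one (by linarith)]
    exact hlogR1
  have hRε : R ^ ε / ε = Real.exp 1 * Real.log R := by
    rw [Real.rpow_def_of_pos hR0, hε, mul_one_div_cancel (by positivity), div_div_eq_mul_div,
      div_one]
  -- The probability that |φ_0| ≥ √(4S) is at most 2 e^{-2S}. `hA` ensures A ≥ 1, so the exponent 2
  -- - ε may be raised to 2.
  set A := a 0 * Real.sqrt (4 * S) with hAdef
  have hAsq : A ^ 2 = 4 * (a 0 ^ 2 * S) := by
    rw [hAdef, mul_pow, Real.sq_sqrt (by positivity)]
    ring
  have hA0 : 0 < A := by positivity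
  have hA1 : 1 ≤ A := by
    by_contra! hlt
    have : A ^ 2 < 1 := by nlinarith
    linarith
  have hApow : A ^ ((2 - ε) * N) ≤ (4 * (a 0 ^ 2 * S)) ^ N := by
    rw [← hAsq, ← pow_mul, ← Real.rpow_natCast]
    refine Real.rpow_le_rpow_of_exponent_le hA1 ?_
    push_cast
    gcongr
    linarith
  have h1 : P {ω | A ≤ ‖φ 0 ω‖ * a 0} ≤ ENNReal.ofReal (2 * Real.exp (-S)) := by
    have h3 := stdComplexGaussian_norm_ge_le (Real.sqrt (4 * S)) (Real.sqrt_nonneg _)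
    rw [← hlaw 0, Measure.map_apply (hm 0) (measurableSet_le measurable_const measurable_norm)]
      at h3
    refine le_trans (measure_mono fun ω hω => ?_) (h3.trans (ENNReal.ofReal_le_ofReal ?_))
    · have hω' : a 0 * Real.sqrt (4 * S) ≤ ‖φ 0 ω‖ * a 0 := hω
      rw [mul_comm] at hω'
      exact le_of_mul_le_mul_right hω' ha0
    · rw [Real.sq_sqrt (by positivity)]
      gcongr
      linarith
  have h2' : P {ω | ENNReal.ofReal R ≤ absSeries a r fun n => φ n ω} ≤
      ENNReal.ofReal (Real.exp (-S)) := by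
    have hmeas : Measurable fun ω => absSeries a r fun n => φ n ω :=
      (measurable_absSeries a r).comp (measurable_pi_iff.2 hm)
    have hmk := meas_ge_le_lintegral_div (μ := P) hmeas.aemeasurable
      (ε := ENNReal.ofReal R) (by simpa using hR0) ENNReal.ofReal_ne_top
    refine hmk.trans ((ENNReal.div_le_div_right
      (lintegral_absSeries_le hm hlaw ha hr0.le hs) _).trans ?_)
    rw [← ENNReal.ofReal_div_of_pos hR0]
    refine ENNReal.ofReal_le_ofReal ?_
    rw [div_le_iff₀ hR0, hR]
    have h3 : Real.exp (-S) * (2 * (2 * N + 1) * Real.exp (3 * S)) =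
        2 * ((2 * N + 1) * Real.exp (2 * S)) := by
      rw [show 2 * S = -S + 3 * S by ring, Real.exp_add]
      ring
    rw [h3]
    have h4 : Real.exp S ≤ Real.exp (2 * S) := Real.exp_le_exp.2 (by linarith)
    have h5 : (2 * (N : ℝ) + 1) * Real.exp S ≤ (2 * N + 1) * Real.exp (2 * S) := by gcongr
    linarith
  have hprod : (∏ n : Fin N, (a n * r ^ (n : ℕ)) ^ 2)⁻¹ ≤
      Real.exp (2 * max 0 (-Real.log (a 0))) * Real.exp (-S) := by
    rw [← Real.exp_add]
    have h3 : ∏ n : Fin N, (a n * r ^ (n : ℕ)) ^ 2 =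
        Real.exp (∑ n ∈ Finset.range N, 2 * logTerm a r n) := by
      rw [Real.exp_sum, Fin.prod_univ_eq_prod_range (fun n => (a n * r ^ n) ^ 2) N]
      refine Finset.prod_congr rfl fun n _ => ?_
      rw [← exp_logTerm ha hr0 n, ← Real.exp_nat_mul]
      norm_num
    rw [h3, ← Real.exp_neg, Real.exp_le_exp, ← Finset.mul_sum]
    obtain ⟨m, hm1⟩ : ∃ m, N = m + 1 := ⟨N - 1, by omega⟩
    rw [hm1, Finset.sum_range_succ'] at hsum ⊢
    have h4 : ∑ n ∈ Finset.range m, max (logTerm a r (n + 1)) 0 =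
        ∑ n ∈ Finset.range m, logTerm a r (n + 1) := Finset.sum_congr rfl fun n hn =>
      max_eq_left (hnonneg (n + 1) (by omega) (by have := Finset.mem_range.1 hn; omega))
    have h5 : logTerm a r 0 = Real.log (a 0) := by simp [logTerm]
    rw [h4, h5] at hsum
    rw [h5]
    -- Only the term n = 0 can have a negative logarithm; it accounts for the constant factor
    -- depending on a_0.
    have h6 : max (Real.log (a 0)) 0 = Real.log (a 0) + max 0 (-Real.log (a 0)) := by
      rcases le_total 0 (Real.log (a 0)) with h | h
      · rw [max_eq_left h, max_eq_left (by linarith)]; ring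
      · rw [max_eq_right h, max_eq_right (by linarith)]; ring
    linarith
  have hmain := measure_holeEvent_le hm hind hlaw ha N hr0 hR0 hε0 (by linarith) hA0
  have hKS : 1 ≤ holeConstant a * S ^ 2 := by
    have h3 : 1 ≤ holeConstant a := le_max_left _ _
    have h4 : 1 ≤ S ^ 2 := one_le_pow₀ (by linarith)
    exact one_le_mul_of_one_le_of_one_le h3 h4
  have hlast : A ^ ((2 - ε) * N) * ((2 * (R ^ ε / ε)) ^ N *
      (∏ n : Fin N, (a n * r ^ (n : ℕ)) ^ 2)⁻¹) ≤ (holeConstant a * S ^ 2) ^ N *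
      (Real.exp (2 * max 0 (-Real.log (a 0))) * Real.exp (-S)) := by
    rw [← mul_assoc, hRε]
    have h3 : A ^ ((2 - ε) * N) * (2 * (Real.exp 1 * Real.log R)) ^ N ≤
        (holeConstant a * S ^ 2) ^ N := by
      calc A ^ ((2 - ε) * N) * (2 * (Real.exp 1 * Real.log R)) ^ N
          ≤ (4 * (a 0 ^ 2 * S)) ^ N * (2 * (Real.exp 1 * (9 * S))) ^ N := by gcongr
        _ = (72 * Real.exp 1 * a 0 ^ 2 * S ^ 2) ^ N := by
            rw [← mul_pow]
            ring_nf
        _ ≤ _ := by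
            gcongr
            exact le_max_right _ _
    have hinv : 0 ≤ (∏ n : Fin N, (a n * r ^ (n : ℕ)) ^ 2)⁻¹ :=
      inv_nonneg.2 (Finset.prod_nonneg fun n _ => by positivity)
    exact mul_le_mul h3 hprod hinv (by positivity)
  have htot : P (holeEvent a φ r) ≤ ENNReal.ofReal (2 * Real.exp (-S) + Real.exp (-S) +
      (holeConstant a * S ^ 2) ^ N *
      (Real.exp (2 * max 0 (-Real.log (a 0))) * Real.exp (-S))) := by
    rw [ENNReal.ofReal_add (by positivity) (by positivity),
      ENNReal.ofReal_add (by positivity) (by positivity)]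
    exact hmain.trans (add_le_add (add_le_add h1 h2') (ENNReal.ofReal_le_ofReal hlast))
  have hfinal := ENNReal.toReal_le_of_le_ofReal (by positivity) htot
  refine hfinal.trans ?_
  have hone : (1 : ℝ) ≤ (holeConstant a * S ^ 2) ^ N := one_le_pow₀ hKS
  have he := Real.exp_pos (-S)
  nlinarith

/-- A function of sublinear growth that bounds the difference between the hole exponent and the
logarithm of the hole probability. -/
noncomputable def errorBound (C K S : ℝ) : ℝ :=
  C + S ^ (3 / 5 : ℝ) * (2 + 4 * Real.log (2 * S) + Real.log (K * S ^ 2))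

theorem errorBound_isLittleO (C K : ℝ) (hK : 0 < K) :
    errorBound C K =o[atTop] fun S : ℝ => S := by
  have h1 : (fun _ : ℝ => C) =o[atTop] fun S : ℝ => S := isLittleO_const_id_atTop C
  have hlog : (fun S : ℝ => 2 + 4 * Real.log (2 * S) + Real.log (K * S ^ 2)) =o[atTop]
      fun S : ℝ => S ^ (2 / 5 : ℝ) := by
    have h2 : (fun S : ℝ => (2 + 4 * Real.log 2 + Real.log K) + 6 * Real.log S) =o[atTop]
        fun S : ℝ => S ^ (2 / 5 : ℝ) := by
      refine IsLittleO.add ?_ ((isLittleO_log_rpow_atTop (by norm_num)).const_mul_left 6)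
      exact isLittleO_const_left.2 (Or.inr (tendsto_norm_atTop_atTop.comp
        (tendsto_rpow_atTop (by norm_num))))
    refine h2.congr' ?_ EventuallyEq.rfl
    filter_upwards [eventually_gt_atTop 0] with S hS
    rw [Real.log_mul two_ne_zero hS.ne', Real.log_mul hK.ne' (by positivity), Real.log_pow]
    push_cast
    ring
  refine h1.add (((isBigO_refl (fun S : ℝ => S ^ (3 / 5 : ℝ)) atTop).mul_isLittleO hlog).congr'
    EventuallyEq.rfl ?_)
  filter_upwards [eventually_gt_atTop 0] with S hS
  rw [← Real.rpow_add hS]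
  norm_num

theorem abs_pHole_sub_holeExponent_le (hm : ∀ n, Measurable (φ n)) (hind : iIndepFun φ P)
    (hlaw : ∀ n, P.map (φ n) = stdComplexGaussian) (ha : ∀ n, 0 < a n) (hc : LogConcaveSeq a)
    (hl : Tendsto (fun n : ℕ => Real.log (a n) / n) atTop atBot) {r : ℝ}
    (hr : max 1 (Real.exp 1 / a 1) ≤ r) (hE : (cutoff a r : ℝ) ^ 5 ≤ holeExponent a r ^ 3)
    (hS : 10 ^ 6 ≤ holeExponent a r) (hA : 1 ≤ a 0 ^ 2 * holeExponent a r) :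
    |pHole P a φ r - holeExponent a r| ≤ errorBound
      (|Real.log (stdComplexGaussian.real {z | 2 / a 0 ≤ ‖z‖} / 2)| +
        Real.log (3 + Real.exp (2 * max 0 (-Real.log (a 0))))) (holeConstant a)
      (holeExponent a r) := by
  have hlow := exp_le_measureReal_holeEvent hm hind hlaw ha hc hl hr hE hS
  have hup := measureReal_holeEvent_le hm hind hlaw ha hc hl hr hE hS hA
  have h2 := two_le_cutoff ha hl hr
  set N := cutoff a r
  set S := holeExponent a r
  set g := stdComplexGaussian.real {z | 2 / a 0 ≤ ‖z‖}
  set c := 3 + Real.exp (2 * max 0 (-Real.log (a 0))) with hcdef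
  have hg : 0 < g := ENNReal.toReal_pos (stdComplexGaussian_norm_ge_pos _).ne' (measure_ne_top _ _)
  have hc1 : 1 ≤ c := by
    have := Real.exp_pos (2 * max 0 (-Real.log (a 0)))
    linarith
  have hS0 : 0 < S := by linarith
  have hN1 : (1 : ℝ) ≤ N := by exact_mod_cast (by omega : 1 ≤ N)
  have hK1 : 1 ≤ holeConstant a := le_max_left _ _
  have hKS : 1 ≤ holeConstant a * S ^ 2 :=
    one_le_mul_of_one_le_of_one_le hK1 (one_le_pow₀ (by linarith))
  -- It is this bound, valid outside the exceptional set, that makes N log N and N log S of order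
  -- o(S).
  have hNS : (N : ℝ) ≤ S ^ (3 / 5 : ℝ) := by
    have h3 : ((N : ℝ) ^ 5) ^ (1 / 5 : ℝ) ≤ (S ^ 3) ^ (1 / 5 : ℝ) := by gcongr
    rw [← Real.rpow_natCast, ← Real.rpow_natCast, ← Real.rpow_mul (by positivity),
      ← Real.rpow_mul hS0.le] at h3
    norm_num at h3
    norm_num
    exact h3
  have hNS' : (N : ℝ) ≤ S := hNS.trans (by
    calc S ^ (3 / 5 : ℝ) ≤ S ^ (1 : ℝ) :=
          Real.rpow_le_rpow_of_exponent_le (by linarith) (by norm_num)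
      _ = S := Real.rpow_one S)
  have hpos : 0 < P.real (holeEvent a φ r) := lt_of_lt_of_le (by positivity) hlow
  have hl1 := Real.log_le_log (by positivity) hlow
  rw [Real.log_mul (by positivity) (Real.exp_ne_zero _), Real.log_exp] at hl1
  have hl2 := Real.log_le_log hpos hup
  rw [Real.log_mul (by positivity) (by positivity), Real.log_mul (by positivity)
    (Real.exp_ne_zero _), Real.log_exp, Real.log_pow] at hl2
  have hlogN : Real.log (2 * N) ≤ Real.log (2 * S) := Real.log_le_log (by positivity) (by linarith)
  have hlogN0 : 0 ≤ Real.log (2 * N) := Real.log_nonneg (by linarith)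
  have hlogK0 : 0 ≤ Real.log (holeConstant a * S ^ 2) := Real.log_nonneg hKS
  have hlogc : 0 ≤ Real.log c := Real.log_nonneg hc1
  have habs := neg_abs_le (Real.log (g / 2))
  have habs0 := abs_nonneg (Real.log (g / 2))
  have e1 : (N : ℝ) * (2 + 4 * Real.log (2 * N) + Real.log (holeConstant a * S ^ 2)) ≤
      S ^ (3 / 5 : ℝ) * (2 + 4 * Real.log (2 * S) + Real.log (holeConstant a * S ^ 2)) := by
    gcongr
  have e2 : 0 ≤ (N : ℝ) * Real.log (2 * N) := by positivity
  have e3 : 0 ≤ (N : ℝ) * Real.log (holeConstant a * S ^ 2) := by positivity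
  rw [pHole, errorBound, abs_le]
  constructor <;> linarith

end Asymptotic

/-- `HasLaw` gives only almost everywhere measurable coefficients, whereas the estimates are for
measurable ones; this allows passing to measurable versions. -/
theorem pHole_congr_ae {Ω : Type*} [MeasurableSpace Ω] {P : Measure Ω} {φ ψ : ℕ → Ω → ℂ}
    (h : ∀ n, φ n =ᵐ[P] ψ n) (a : ℕ → ℝ) (r : ℝ) : pHole P a φ r = pHole P a ψ r := by
  rw [pHole, pHole, measureReal_congr (s := holeEvent a φ r) (t := holeEvent a ψ r)]
  filter_upwards [ae_all_iff.2 h] with ω hω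
  have : (fun n => φ n ω) = fun n => ψ n ω := funext hω
  exact propext (show (∀ z : ℂ, ‖z‖ < r → gaussianSeries a (fun n => φ n ω) z ≠ 0) ↔
    ∀ z : ℂ, ‖z‖ < r → gaussianSeries a (fun n => ψ n ω) z ≠ 0 by rw [this])

theorem logConcaveSeq_of_concaveOn {a : ℝ → ℝ}
    (h : ConcaveOn ℝ (Set.Ici 0) fun t => Real.log (a t)) : LogConcaveSeq fun n => a n := by
  intro x y z hxy hyz
  have hxy' : (x : ℝ) < y := by exact_mod_cast hxy
  have hyz' : (y : ℝ) < z := by exact_mod_cast hyz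
  have h1 := h.slope_anti_adjacent (Set.mem_Ici.2 x.cast_nonneg) (Set.mem_Ici.2 z.cast_nonneg)
    hxy' hyz'
  rwa [div_le_div_iff₀ (by linarith) (by linarith)] at h1

theorem theorem1 (a : ℝ → ℝ)
    (ha_pos : ∀ t : ℝ, 0 ≤ t → 0 < a t)
    (ha_concave : ConcaveOn ℝ (Set.Ici 0) fun t => Real.log (a t))
    (ha_lim : Tendsto (fun t : ℝ => Real.log (a t) / t) atTop atBot) :
    ∃ E : Set ℝ, HasFiniteLogMeasure E ∧
      ∀ (Ω : Type*) [MeasurableSpace Ω] (P : Measure Ω) [IsProbabilityMeasure P]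
        (φ : ℕ → Ω → ℂ),
        iIndepFun φ P → (∀ n, HasLaw (φ n) stdComplexGaussian P) →
        (fun r : ℝ => pHole P (fun n => a n) φ r - holeExponent (fun n => a n) r)
          =o[atTop ⊓ 𝓟 Eᶜ] fun r : ℝ => holeExponent (fun n => a n) r := by
  have ha : ∀ n : ℕ, 0 < (fun n : ℕ => a n) n := fun n => ha_pos n n.cast_nonneg
  have hc := logConcaveSeq_of_concaveOn ha_concave
  have hl : Tendsto (fun n : ℕ => Real.log ((fun n : ℕ => a n) n) / n) atTop atBot :=
    ha_lim.comp tendsto_natCast_atTop_atTop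
  obtain ⟨E, hE, hgood⟩ := exists_exceptional_set ha hc hl
  refine ⟨E, hE, fun Ω _ P _ φ hind hlaw => ?_⟩
  have hae : ∀ n, φ n =ᵐ[P] (hlaw n).aemeasurable.mk (φ n) := fun n =>
    (hlaw n).aemeasurable.ae_eq_mk
  have hlaw' : ∀ n, P.map ((hlaw n).aemeasurable.mk (φ n)) = stdComplexGaussian := fun n => by
    rw [← Measure.map_congr (hae n), (hlaw n).map_eq]
  have hS := tendsto_holeExponent ha hl
  refine IsBigO.trans_isLittleO ?_ (((errorBound_isLittleO
    (|Real.log (stdComplexGaussian.real {z | 2 / (fun n : ℕ => a n) 0 ≤ ‖z‖} / 2)| +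
      Real.log (3 + Real.exp (2 * max 0 (-Real.log ((fun n : ℕ => a n) 0)))))
    (holeConstant fun n : ℕ => a n) (lt_of_lt_of_le one_pos (le_max_left _ _))).comp_tendsto
      hS).mono inf_le_left)
  refine IsBigO.of_bound 1 ?_
  have h0 : 0 < a (0 : ℕ) ^ 2 := pow_pos (ha 0) 2
  filter_upwards [mem_inf_of_left (eventually_ge_atTop (max 1 (Real.exp 1 / a (1 : ℕ)))),
    mem_inf_of_left (hS.eventually_ge_atTop (10 ^ 6)),
    mem_inf_of_left (hS.eventually_ge_atTop (1 / a (0 : ℕ) ^ 2)),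
    mem_inf_of_right (mem_principal_self Eᶜ)] with r hr hr6 hrA hrE
  have hA : 1 ≤ a (0 : ℕ) ^ 2 * holeExponent (fun n : ℕ => a n) r := by
    rw [div_le_iff₀ h0] at hrA
    linarith
  rw [pHole_congr_ae hae, one_mul, Real.norm_eq_abs, Real.norm_eq_abs]
  exact (abs_pHole_sub_holeExponent_le (fun n => (hlaw n).aemeasurable.measurable_mk)
    (hind.congr hae) hlaw' ha hc hl hr (hgood r hr hrE) hr6 hA).trans (le_abs_self _)
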